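/- Let $-\infty\le a<b\le+\infty$, let $S_{a,b}=\{z\in\mathbb C: a<\operatorname{Im} z<b\}$ and let $f$ be a holomorphic function on $S_{a,b}$. For $y\in(a,b)$ put $F_y(x)=f(x+iy)$ ($x\in\mathbb R$), and put $G(y)=f(iy)$ for $y\in(a,b)$. Measures are non-negative Borel measures on $\mathbb R$; such a measure is called a Lebesgue–Stieltjes measure if it is finite on bounded sets. Integral representations include the absolute convergence of the integrals. The following are equivalent: 1. $f$ is positive definite on $S_{a,b}$: for all $n\in\mathbb N$, all $z_1,\dots,z_n\in\mathbb C$ with $z_k-\overline{z_l}\in S_{a,b}$ for all $k,l$, and all $\xi_1,\dots,\xi_n\in\mathbb C$, $\sum_{k,l=1}^n f(z_k-\overline{z_l})\,\xi_k\overline{\xi_l}\ge 0$. 2. There is a Lebesgue–Stieltjes measure $\mu$ with $f(z)=\int_{\mathbb R} e^{itz}\,d\mu(t)$ for all $z\in S_{a,b}$. 3. For some $y\in(a,b)$, $F_y$ is positive definite on $\mathbb R$: $\sum_{k,l=1}^n F_y(x_k-x_l)\,\xi_k\overline{\xi_l}\ge0$ for all $n\in\mathbb N$, $x_1,\dots,x_n\in\mathbb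 R$ and $\xi_1,\dots,\xi_n\in\mathbb C$. 4. For some $y\in(a,b)$ there is a finite measure $\mu_y$ with $F_y(x)=\int_{\mathbb R} e^{itx}\,d\mu_y(t)$ for all $x\in\mathbb R$. 5. $G$ is co-positive definite on $(a,b)$: for all $n\in\mathbb N$, all $x_1,\dots,x_n\in\mathbb R$ with $x_k+x_l\in(a,b)$ for all $k,l$, and all $\xi_1,\dots,\xi_n\in\mathbb C$, $\sum_{k,l=1}^n G(x_k+x_l)\,\xi_k\overline{\xi_l}\ge0$. 6. There is a Lebesgue–Stieltjes measure $\mu_I$ with $G(y)=\int_{\mathbb R} e^{-yt}\,d\mu_I(t)$ for all $y\in(a,b)$. Suppose moreover that these conditions hold. Then a measure $\mu_y$ as in (4) exists for every $y\in(a,b)$, and: (i) The measure $\mu$ in (2), the measure $\mu_I$ in (6) and, for each $y\in(a,b)$, the measure $\mu_y$ representing $F_y$ as in (4) are uniquely determined by $f$, and $\mu=\mu_I$. (ii) $\int_{\mathbb R} e^{-ut}\,d\mu(t)<\infty$ for all $u\in(a,b)$, and for each $y\in(a,b)$, $\int_{\mathbb R} e^{-ut}\,d\mu_y(t)<\infty$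 for all $u\in(a-y,b-y)$ (that is, $\mu$ and $\mu_y$ are exponentially finite with respect to these intervals). (iii) The functions $f$ on $S_{a,b}$, $F_y$ on $\mathbb R$ (for each $y\in(a,b)$) and $G$ on $(a,b)$ are infinitely differentiable and can be differentiated under the integral sign: for all $n\ge0$, $$f^{(n)}(z)=\int_{\mathbb R}(it)^n e^{itz}\,d\mu(t),\qquad F_y^{(n)}(x)=\int_{\mathbb R}(it)^n e^{itx}\,d\mu_y(t),\qquad G^{(n)}(y)=\int_{\mathbb R}(-t)^n e^{-yt}\,d\mu(t),$$ for $z\in S_{a,b}$, $x\in\mathbb R$ and $y\in(a,b)$ respectively, with absolutely convergent integrals. -/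

import Mathlib

open MeasureTheory
open scoped ComplexOrder ContDiff

/-- The horizontal strip `{z ∈ ℂ : a < Im z < b}`, with extended real endpoints. -/
def horizontalStrip (a b : EReal) : Set ℂ :=
  {z : ℂ | a < (z.im : EReal) ∧ (z.im : EReal) < b}

/-- The open interval `(a, b)` of real numbers, with extended real endpoints. -/
def realInterval (a b : EReal) : Set ℝ :=
  {y : ℝ | a < (y : EReal) ∧ (y : EReal) < b}

/-- `F : ℝ → ℂ` is positive definite. The order on `ℂ` is the usual one, so `0 ≤ w` says that
`w` is real and non-negative. -/
def IsPosDefReal (F : ℝ → ℂ) : Prop :=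
  ∀ (n : ℕ) (x : Fin n → ℝ) (ξ : Fin n → ℂ),
    0 ≤ ∑ k, ∑ l, F (x k - x l) * ξ k * starRingEnd ℂ (ξ l)

/-- `G` is co-positive definite on the set `J ⊆ ℝ` (only the values of `G` on `J` matter). -/
def IsCoPosDefOn (G : ℝ → ℂ) (J : Set ℝ) : Prop :=
  ∀ (n : ℕ) (x : Fin n → ℝ), (∀ k l, x k + x l ∈ J) → ∀ ξ : Fin n → ℂ,
    0 ≤ ∑ k, ∑ l, G (x k + x l) * ξ k * starRingEnd ℂ (ξ l)

/-- `f` is a positive definite function of a complex variable on the set `S ⊆ ℂ` (only the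
values of `f` on `S` matter). -/
def IsPosDefOn (f : ℂ → ℂ) (S : Set ℂ) : Prop :=
  ∀ (n : ℕ) (z : Fin n → ℂ), (∀ k l, z k - starRingEnd ℂ (z l) ∈ S) → ∀ ξ : Fin n → ℂ,
    0 ≤ ∑ k, ∑ l, f (z k - starRingEnd ℂ (z l)) * ξ k * starRingEnd ℂ (ξ l)

/-- `f(z) = ∫ e^{itz} dμ(t)` for all `z ∈ S`, the integrals being absolutely convergent. -/
def FourierLaplaceRep (f : ℂ → ℂ) (S : Set ℂ) (μ : Measure ℝ) : Prop :=
  ∀ z ∈ S, Integrable (fun t : ℝ => Complex.exp (Complex.I * t * z)) μ ∧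
    f z = ∫ t : ℝ, Complex.exp (Complex.I * t * z) ∂μ

/-- `F(x) = ∫ e^{itx} dμ(t)` for all real `x`, the integrals being absolutely convergent. -/
def BochnerRep (F : ℝ → ℂ) (μ : Measure ℝ) : Prop :=
  ∀ x : ℝ, Integrable (fun t : ℝ => Complex.exp (Complex.I * t * x)) μ ∧
    F x = ∫ t : ℝ, Complex.exp (Complex.I * t * x) ∂μ

/-- `G(y) = ∫ e^{-yt} dμ(t)` for all `y ∈ J`, the integrals being absolutely convergent. -/
def WidderRep (G : ℝ → ℂ) (J : Set ℝ) (μ : Measure ℝ) : Prop :=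
  ∀ y ∈ J, Integrable (fun t : ℝ => Real.exp (-(y * t))) μ ∧
    G y = ((∫ t : ℝ, Real.exp (-(y * t)) ∂μ : ℝ) : ℂ)

/-- `μ` is exponentially finite with respect to `J`: `∫ e^{-yt} dμ(t) < ∞` for every `y ∈ J`. -/
def IsExpFinite (μ : Measure ℝ) (J : Set ℝ) : Prop :=
  ∀ y ∈ J, ∫⁻ t : ℝ, ENNReal.ofReal (Real.exp (-(y * t))) ∂μ < ⊤

/-- The section `F_y : x ↦ f(x + iy)`. -/
def horizontalSection (f : ℂ → ℂ) (y : ℝ) : ℝ → ℂ :=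
  fun x => f ((x : ℂ) + Complex.I * (y : ℂ))

/-- The section `G : y ↦ f(iy)`. -/
def imaginarySection (f : ℂ → ℂ) : ℝ → ℂ :=
  fun y => f (Complex.I * (y : ℂ))

/-!
The proof reduces every condition to a moment problem at a single point `iy` of the imaginary axis.

Both a positive definite horizontal section `F_y` and a co-positive definite `G` say that a kernel
`f (iy + w x - conj (w x'))` is positive definite for small real `x, x'`, with `w = 1` and `w = i`
respectively. Passing to derivatives at the origin by divided differences, the numbers
`sₙ = (-i)ⁿ f⁽ⁿ⁾(iy)` have positive semidefinite Hankel matrices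
(`hankel_nonneg_of_local_posDef`). By Hamburger's theorem they are the moments of a measure `ν` on
`ℝ` (`exists_measure_of_nonneg_on_squares`), which is obtained from the M. Riesz extension theorem
on polynomials together with compactly supported functions, the Riesz–Markov theorem, and the fact
that non-negative real polynomials are sums of squares (`isSumSq_of_eval_nonneg`).

Since `f` is holomorphic near `iy`, its Taylor series converges absolutely there; its even part is,
up to signs, the termwise integral of the series of `cosh`, whose terms are non-negative, so
`∫ e^{-(u-y)t} dν(t)` converges whenever `iu` lies in a disc about `iy` contained in the strip
(`integrable_exp_of_moments`).
On such a disc `f` is the Fourier–Laplace integral of `μ = e^{yt} ν`. The same argument at any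
other point where the integral is already known to represent `f` yields convergence on a disc as
large as the strip allows, so the domain of convergence is relatively closed in `(a, b)` as well as
open, and the representation holds on the whole strip (`fourierLaplace_of_moments`).

The converse implications are positivity of Gram matrices (`sum_integral_mul_conj_nonneg`). The
measures `μ_y` are the exponential tilts `e^{-yt} μ`. Uniqueness follows from uniqueness for
characteristic functions and, for `μ_I`, from the identity theorem applied to the Laplace
transforms (`WidderRep.unique`). The derivatives come from differentiating the Fourier–Laplace
integral inside its domain of convergence and restricting to horizontal and vertical lines.
-/

/-! ### Non-negative real polynomials are sums of squares -/

open Polynomial in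
/-- The square root of a non-negative constant exhibits it as a sum of squares. -/
theorem isSumSq_C_of_nonneg {c : ℝ} (hc : 0 ≤ c) : IsSumSq (C c : ℝ[X]) := by
  have h : (C c : ℝ[X]) = C (√c) * C (√c) := by rw [← C_mul, Real.mul_self_sqrt hc]
  rw [h]
  exact IsSumSq.mul_self _

open Polynomial in
/-- A real polynomial that is non-negative on `ℝ` is a sum of squares: real roots have even
multiplicity, and a non-real root splits off a factor `(X - Re z)² + (Im z)²`. -/
theorem isSumSq_of_eval_nonneg (p : ℝ[X]) (hp : ∀ x, 0 ≤ p.eval x) : IsSumSq p := by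
  induction hn : p.natDegree using Nat.strong_induction_on generalizing p with
  | _ n ih =>
  subst hn
  rcases Nat.eq_zero_or_pos p.natDegree with h0 | h0
  · rw [eq_C_of_natDegree_eq_zero h0] at hp ⊢
    exact isSumSq_C_of_nonneg (by simpa using hp 0)
  have hp0 : p ≠ 0 := by rintro rfl; simp at h0
  obtain ⟨z, hz⟩ := IsAlgClosed.exists_aeval_eq_zero ℂ p (natDegree_pos_iff_degree_pos.1 h0).ne'
  by_cases him : z.im = 0
  · set a := z.re
    have hza : z = (a : ℂ) := Complex.ext rfl (by simpa using him)
    have hroot : p.IsRoot a := by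
      rw [hza, ← Complex.coe_algebraMap, aeval_algebraMap_apply] at hz
      simpa using hz
    have hmin : IsLocalMin (fun x => p.eval x) a :=
      Filter.Eventually.of_forall fun x => by simpa [hroot.eq_zero] using hp x
    have hder : (derivative p).IsRoot a := by
      have := hmin.deriv_eq_zero
      rwa [Polynomial.deriv] at this
    have hmult : 1 < p.rootMultiplicity a :=
      (one_lt_rootMultiplicity_iff_isRoot hp0).2 ⟨hroot, hder⟩
    obtain ⟨q, hq⟩ := (le_rootMultiplicity_iff hp0).1 (Nat.succ_le_of_lt hmult)
    have hq0 : q ≠ 0 := by rintro rfl; simp at hq; exact hp0 hq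
    have hdeg : p.natDegree = 2 + q.natDegree := by
      have h2 : ((X - C a) ^ 2 : ℝ[X]) ≠ 0 := pow_ne_zero _ (X_sub_C_ne_zero a)
      conv_lhs => rw [hq]
      rw [natDegree_mul h2 hq0, natDegree_pow, natDegree_X_sub_C]
    have hqnn : ∀ x, 0 ≤ q.eval x := by
      have hcl : IsClosed {x | 0 ≤ q.eval x} := isClosed_le continuous_const q.continuous
      have hsub : ({a}ᶜ : Set ℝ) ⊆ {x | 0 ≤ q.eval x} := by
        intro x hx
        have h1 := hp x
        rw [hq] at h1
        simp only [eval_mul, eval_pow, eval_sub, eval_X, eval_C] at h1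
        have h2 : 0 < (x - a) ^ 2 := by
          have : x - a ≠ 0 := sub_ne_zero.2 hx
          positivity
        exact nonneg_of_mul_nonneg_right h1 h2
      intro x
      have := hcl.closure_subset_iff.2 hsub
      rw [(dense_compl_singleton a).closure_eq] at this
      exact this (Set.mem_univ x)
    rw [hq, pow_two]
    exact (IsSumSq.mul_self _).mul (ih _ (by omega) q hqnn rfl)
  · obtain ⟨q, hq⟩ := p.quadratic_dvd_of_aeval_eq_zero_im_ne_zero hz him
    set r : ℝ[X] := X ^ 2 - C (2 * z.re) * X + C (‖z‖ ^ 2) with hr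
    have hr' : r = (X - C z.re) * (X - C z.re) + C z.im * C z.im := by
      rw [hr, ← Complex.normSq_eq_norm_sq, Complex.normSq_apply]
      simp only [C_mul, C_add, map_ofNat]
      ring
    have hreval : ∀ x, 0 < r.eval x := by
      intro x
      rw [hr']
      simp only [eval_add, eval_mul, eval_sub, eval_X, eval_C]
      have : 0 < z.im * z.im := mul_self_pos.2 him
      nlinarith [mul_self_nonneg (x - z.re)]
    have hq0 : q ≠ 0 := by rintro rfl; simp at hq; exact hp0 hq
    have hr0 : r ≠ 0 := by intro h; simpa [h] using hreval 0
    have hrdeg : r.natDegree = 2 := by rw [hr]; compute_degree!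
    have hdeg : p.natDegree = 2 + q.natDegree := by
      conv_lhs => rw [hq]
      rw [natDegree_mul hr0 hq0, hrdeg]
    rw [hq]
    refine IsSumSq.mul ?_ (ih _ (by omega) q (fun x => ?_) rfl)
    · rw [hr']
      exact (IsSumSq.mul_self _).add (IsSumSq.mul_self _)
    · have h1 := hp x
      rw [hq, eval_mul] at h1
      exact nonneg_of_mul_nonneg_right h1 (hreval x)

/-! ### Hamburger's moment theorem -/

/-- The continuous cutoff that is `1` on `[-n, n]` and vanishes outside `[-(n+1), n+1]`. -/
noncomputable def cutoff (n : ℕ) (x : ℝ) : ℝ := max 0 (min 1 (n + 1 - |x|))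

theorem continuous_cutoff (n : ℕ) : Continuous (cutoff n) := by
  unfold cutoff; fun_prop

theorem cutoff_nonneg (n : ℕ) (x : ℝ) : 0 ≤ cutoff n x := le_max_left _ _

theorem cutoff_le_one (n : ℕ) (x : ℝ) : cutoff n x ≤ 1 :=
  max_le zero_le_one (min_le_left _ _)

theorem cutoff_eq_one {n : ℕ} {x : ℝ} (h : |x| ≤ n) : cutoff n x = 1 := by
  unfold cutoff
  rw [min_eq_left (by linarith), max_eq_right zero_le_one]

theorem hasCompactSupport_cutoff (n : ℕ) : HasCompactSupport (cutoff n) := by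
  refine HasCompactSupport.intro (isCompact_Icc (a := -((n : ℝ) + 1)) (b := n + 1)) fun x hx => ?_
  have : (n : ℝ) + 1 < |x| := by
    by_contra! h
    exact hx (abs_le.1 h)
  unfold cutoff
  rw [min_eq_right (by linarith), max_eq_left (by linarith)]

theorem tendsto_cutoff (x : ℝ) :
    Filter.Tendsto (fun n => cutoff n x) Filter.atTop (nhds 1) := by
  refine tendsto_const_nhds.congr' ?_
  obtain ⟨N, hN⟩ := exists_nat_ge |x|
  filter_upwards [Filter.eventually_ge_atTop N] with n hn
  exact (cutoff_eq_one (hN.trans (by exact_mod_cast hn))).symm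

open Polynomial in
/-- The truncation of a polynomial by the cutoff, as a compactly supported function. -/
noncomputable def truncation (p : ℝ[X]) (n : ℕ) : CompactlySupportedContinuousMap ℝ ℝ where
  toFun x := p.eval x * cutoff n x
  continuous_toFun := p.continuous.mul (continuous_cutoff n)
  hasCompactSupport' := (hasCompactSupport_cutoff n).mul_left

open Polynomial in
theorem truncation_apply (p : ℝ[X]) (n : ℕ) (x : ℝ) :
    truncation p n x = p.eval x * cutoff n x := rfl

open Polynomial in
/-- A linear functional on polynomials that is non-negative on squares extends, jointly with a
linear functional on `C_c(ℝ)`, to one that is non-negative on all sums `p + φ ≥ 0`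
(M. Riesz extension). -/
theorem exists_joint_extension (L : ℝ[X] →ₗ[ℝ] ℝ) (hL : ∀ p, 0 ≤ L (p * p)) :
    ∃ g : (ℝ[X] × CompactlySupportedContinuousMap ℝ ℝ) →ₗ[ℝ] ℝ,
      (∀ p, g (p, 0) = L p) ∧ ∀ y, (∀ x, 0 ≤ y.1.eval x + y.2 x) → 0 ≤ g y := by
  have hLss : ∀ p, IsSumSq p → 0 ≤ L p := by
    intro p hp
    induction hp with
    | zero => simp
    | sq_add a _ ih => rw [map_add]; exact add_nonneg (hL a) ih
  let E := ℝ[X] × CompactlySupportedContinuousMap ℝ ℝ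
  let s : PointedCone ℝ E :=
    { carrier := {y | ∀ x, 0 ≤ y.1.eval x + y.2 x}
      add_mem' := by
        intro y z hy hz x
        have h1 := hy x
        have h2 := hz x
        change 0 ≤ (y.1 + z.1).eval x + (y.2 x + z.2 x)
        rw [eval_add]
        linarith
      zero_mem' := by intro x; simp
      smul_mem' := by
        intro c y hy x
        have h1 := mul_nonneg c.2 (hy x)
        have h2 : ((c • y).1.eval x + (c • y).2 x) = (c : ℝ) * (y.1.eval x + y.2 x) := by
          change ((c : ℝ) • y.1).eval x + ((c : ℝ) • y.2) x = _
          rw [eval_smul, CompactlySupportedContinuousMap.smul_apply]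
          simp only [smul_eq_mul]
          ring
        change 0 ≤ ((c • y).1.eval x + (c • y).2 x)
        rw [h2]
        exact h1 }
  let f : E →ₗ.[ℝ] ℝ :=
    { domain := Submodule.prod (⊤ : Submodule ℝ ℝ[X]) ⊥
      toFun := (L ∘ₗ LinearMap.fst ℝ _ _) ∘ₗ Submodule.subtype _ }
  have hpos : ∀ y : f.domain, (y : E) ∈ s → 0 ≤ f y := by
    rintro ⟨⟨p, φ⟩, hx⟩ hmem
    have hφ : φ = 0 := (Submodule.mem_prod.1 hx).2
    subst hφ
    exact hLss p (isSumSq_of_eval_nonneg p fun x => by simpa using hmem x)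
  have hcof : ∀ y : E, ∃ x : f.domain, (x : E) + y ∈ s := by
    rintro ⟨p, φ⟩
    obtain ⟨K, hK⟩ := φ.continuous.bounded_above_of_compact_support φ.hasCompactSupport
    refine ⟨⟨(C K - p, 0), Submodule.mem_top, Submodule.zero_mem ⊥⟩, fun x => ?_⟩
    have h1 : -K ≤ φ x := (abs_le.1 (hK x)).1
    have h2 : (C K - p + p).eval x + (0 + φ x) = K + φ x := by simp
    exact (by linarith : 0 ≤ K + φ x).trans_eq h2.symm
  obtain ⟨g, hg1, hg2⟩ := riesz_extension s f hpos hcof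
  exact ⟨g, fun p => hg1 ⟨(p, 0), Submodule.mem_top, Submodule.zero_mem ⊥⟩, fun y hy => hg2 y hy⟩

open Polynomial in
/-- **Hamburger's theorem**: a linear functional on real polynomials that is non-negative on
squares is integration against a measure. -/
theorem exists_measure_of_nonneg_on_squares (L : ℝ[X] →ₗ[ℝ] ℝ) (hL : ∀ p, 0 ≤ L (p * p)) :
    ∃ μ : Measure ℝ, ∀ p : ℝ[X], Integrable (fun x => p.eval x) μ ∧ ∫ x, p.eval x ∂μ = L p := by
  obtain ⟨g, hgL, hg⟩ := exists_joint_extension L hL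
  have hgmono : ∀ y z : ℝ[X] × CompactlySupportedContinuousMap ℝ ℝ,
      (∀ x, y.1.eval x + y.2 x ≤ z.1.eval x + z.2 x) → g y ≤ g z := by
    intro y z h
    have := hg (z - y) fun x => by
      have := h x
      simp
      linarith
    rw [map_sub] at this
    linarith
  let Λ : CompactlySupportedContinuousMap ℝ ℝ →ₚ[ℝ] ℝ :=
    PositiveLinearMap.mk₀ (g ∘ₗ LinearMap.inr ℝ _ _) fun φ hφ => hg _ fun x => by
      simpa using hφ x
  let μ := RealRMK.rieszMeasure Λ
  have hμ : ∀ φ : CompactlySupportedContinuousMap ℝ ℝ, ∫ x, φ x ∂μ = g (0, φ) :=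
    fun φ => RealRMK.integral_rieszMeasure Λ φ
  have hint : ∀ φ : CompactlySupportedContinuousMap ℝ ℝ, Integrable (fun x => φ x) μ :=
    fun φ => φ.continuous.integrable_of_hasCompactSupport φ.hasCompactSupport
  -- `∫ p χₙ ≤ L p`, so non-negative polynomials are integrable, by Fatou's lemma
  have hnn : ∀ p : ℝ[X], (∀ x, 0 ≤ p.eval x) → Integrable (fun x => p.eval x) μ := by
    intro p hp
    refine integrable_of_tendsto (G := fun n x => truncation p n x)
      (ae_of_all _ fun x => ?_) (fun n => (truncation p n).continuous.aestronglyMeasurable) ?_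
    · simpa [truncation_apply] using (tendsto_cutoff x).const_mul (p.eval x)
    · refine ne_top_of_le_ne_top (b := ENNReal.ofReal (L p)) ENNReal.ofReal_ne_top ?_
      refine Filter.liminf_le_of_le (by isBoundedDefault) fun b hb => ?_
      obtain ⟨n, hn⟩ := hb.exists
      refine hn.trans ?_
      rw [← hgL, ← ofReal_integral_norm_eq_lintegral_enorm (hint _)]
      refine ENNReal.ofReal_le_ofReal ?_
      have habs : ∀ x, ‖truncation p n x‖ = truncation p n x := fun x =>
        Real.norm_of_nonneg (mul_nonneg (hp x) (cutoff_nonneg n x))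
      simp_rw [habs, hμ]
      refine hgmono _ _ fun x => ?_
      have := mul_le_of_le_one_right (hp x) (cutoff_le_one n x)
      simpa [truncation_apply] using this
  have hpint : ∀ p : ℝ[X], Integrable (fun x => p.eval x) μ := by
    intro p
    have h1 := (hnn (p * p + 1) fun x => by simp; nlinarith [mul_self_nonneg (p.eval x)])
    refine h1.mono' p.continuous.aestronglyMeasurable (ae_of_all _ fun x => ?_)
    simp only [eval_add, eval_mul, eval_one, Real.norm_eq_abs]
    exact abs_le.2 ⟨by nlinarith [mul_self_nonneg (p.eval x + 1)],
      by nlinarith [mul_self_nonneg (p.eval x - 1)]⟩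
  refine ⟨μ, fun p => ⟨hpint p, ?_⟩⟩
  have h1 : Filter.Tendsto (fun n => ∫ x, truncation p n x ∂μ) Filter.atTop
      (nhds (∫ x, p.eval x ∂μ)) := by
    refine tendsto_integral_of_dominated_convergence (fun x => |p.eval x|)
      (fun n => (truncation p n).continuous.aestronglyMeasurable) (hpint p).abs
      (fun n => ae_of_all _ fun x => ?_) (ae_of_all _ fun x => ?_)
    · rw [truncation_apply, norm_mul, Real.norm_eq_abs, Real.norm_eq_abs,
        abs_of_nonneg (cutoff_nonneg n x)]
      exact mul_le_of_le_one_right (abs_nonneg _) (cutoff_le_one n x)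
    · simpa [truncation_apply] using (tendsto_cutoff x).const_mul (p.eval x)
  -- `|p - p χₙ| ≤ q / (n + 1)` for a polynomial `q` growing faster than `p`
  let q : ℝ[X] := (X ^ 2 + 1) * (p * p + 1)
  have hbound : ∀ (n : ℕ) x, |p.eval x - p.eval x * cutoff n x| ≤ ((n : ℝ) + 1)⁻¹ * q.eval x := by
    intro n x
    have hqx : q.eval x = (x ^ 2 + 1) * (p.eval x * p.eval x + 1) := by simp [q]
    rw [hqx, ← mul_one_sub, abs_mul, abs_of_nonneg (sub_nonneg.2 (cutoff_le_one n x))]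
    have hn : (0 : ℝ) < n + 1 := by positivity
    by_cases hx : |x| ≤ n
    · rw [cutoff_eq_one hx]
      simp only [sub_self, mul_zero]
      have := mul_self_nonneg (p.eval x)
      positivity
    · have h2 : |p.eval x| ≤ p.eval x * p.eval x + 1 :=
        abs_le.2 ⟨by nlinarith [mul_self_nonneg (p.eval x + 1)],
          by nlinarith [mul_self_nonneg (p.eval x - 1)]⟩
      have h3 : |p.eval x| * (1 - cutoff n x) ≤ p.eval x * p.eval x + 1 :=
        (mul_le_of_le_one_right (abs_nonneg _) (by linarith [cutoff_nonneg n x])).trans h2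
      have h4 : (n : ℝ) + 1 ≤ x ^ 2 + 1 := by
        push Not at hx
        rcases Nat.eq_zero_or_pos n with rfl | hpos
        · simp; positivity
        · have h5 : (1 : ℝ) ≤ n := by exact_mod_cast hpos
          rw [← sq_abs]
          nlinarith
      rw [inv_mul_eq_div, le_div_iff₀ hn]
      have h0 : 0 ≤ p.eval x * p.eval x + 1 := (abs_nonneg _).trans h2
      calc _ ≤ (p.eval x * p.eval x + 1) * ((n : ℝ) + 1) := by gcongr
        _ ≤ _ := by rw [mul_comm]; gcongr
  have h2 : Filter.Tendsto (fun n => ∫ x, truncation p n x ∂μ) Filter.atTop (nhds (L p)) := by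
    rw [tendsto_iff_dist_tendsto_zero]
    have hlim : Filter.Tendsto (fun n : ℕ => ((n : ℝ) + 1)⁻¹ * L q) Filter.atTop (nhds 0) := by
      have := tendsto_one_div_add_atTop_nhds_zero_nat (𝕜 := ℝ)
      simpa using this.mul_const (L q)
    refine squeeze_zero (fun _ => dist_nonneg) (fun n => ?_) hlim
    have hsm : g (((n : ℝ) + 1)⁻¹ • q, 0) = ((n : ℝ) + 1)⁻¹ * L q := by
      rw [hgL, map_smul, smul_eq_mul]
    have hsplit : g (p, -truncation p n) = L p - ∫ x, truncation p n x ∂μ := by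
      rw [hμ, ← hgL, ← map_sub]
      simp
    have hsplit' : g (-p, truncation p n) = (∫ x, truncation p n x ∂μ) - L p := by
      rw [hμ, ← hgL, ← map_sub]
      simp
    rw [Real.dist_eq, abs_le, ← hsm, ← hsplit', neg_le]
    have hneg : -g (-p, truncation p n) = g (p, -truncation p n) := by
      rw [hsplit, hsplit']; ring
    rw [hneg]
    constructor
    · refine hgmono _ _ fun x => ?_
      have := (abs_le.1 (hbound n x)).2
      simp only [eval_smul, smul_eq_mul, CompactlySupportedContinuousMap.coe_neg, Pi.neg_apply,
        truncation_apply, CompactlySupportedContinuousMap.coe_zero, Pi.zero_apply]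
      linarith
    · refine hgmono _ _ fun x => ?_
      have := (abs_le.1 (hbound n x)).1
      simp only [eval_smul, smul_eq_mul, eval_neg,
        truncation_apply, CompactlySupportedContinuousMap.coe_zero, Pi.zero_apply]
      linarith
  exact tendsto_nhds_unique h1 h2

open Polynomial in
/-- The linear extension `∑ aₙ Xⁿ ↦ ∑ aₙ sₙ` of a moment sequence to polynomials. -/
noncomputable def momentFunctional (s : ℕ → ℂ) : ℝ[X] →ₗ[ℝ] ℂ :=
  Polynomial.lsum fun n => LinearMap.toSpanSingleton ℝ ℂ (s n)

open Polynomial in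
theorem momentFunctional_monomial (s : ℕ → ℂ) (n : ℕ) (a : ℝ) :
    momentFunctional s (monomial n a) = a * s n := by
  simp [momentFunctional, Polynomial.lsum_apply]

open Polynomial in
theorem momentFunctional_mul_self (s : ℕ → ℂ) (p : ℝ[X]) :
    momentFunctional s (p * p) = ∑ a : Fin (p.natDegree + 1), ∑ b : Fin (p.natDegree + 1),
      s (a + b) * p.coeff a * p.coeff b := by
  conv_lhs => rw [p.as_sum_range, Finset.sum_mul_sum]
  simp only [monomial_mul_monomial, map_sum, momentFunctional_monomial]
  rw [Finset.sum_range]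
  refine Finset.sum_congr rfl fun a _ => ?_
  rw [Finset.sum_range]
  refine Finset.sum_congr rfl fun b _ => ?_
  push_cast
  ring

open Polynomial in
/-- Hamburger's theorem for a complex sequence: positivity on squares already forces the
sequence to be real, since `p = ((p + 1) / 2)² - ((p - 1) / 2)²`. -/
theorem exists_measure_of_momentFunctional_nonneg (s : ℕ → ℂ)
    (hs : ∀ p : ℝ[X], 0 ≤ momentFunctional s (p * p)) :
    ∃ ν : Measure ℝ, ∀ n : ℕ, Integrable (fun t : ℝ => t ^ n) ν ∧
      s n = ((∫ t : ℝ, t ^ n ∂ν : ℝ) : ℂ) := by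
  have him : ∀ p, (momentFunctional s p).im = 0 := by
    intro p
    have h4 : (C 2⁻¹ * C 2 : ℝ[X]) = 1 := by rw [← C_mul]; simp
    have hp : p = (C 2⁻¹ * (p + 1)) * (C 2⁻¹ * (p + 1)) - (C 2⁻¹ * (p - 1)) * (C 2⁻¹ * (p - 1)) := by
      calc p = (C 2⁻¹ * C 2) * (C 2⁻¹ * C 2) * p := by rw [h4]; ring
        _ = _ := by rw [map_ofNat]; ring
    rw [hp, map_sub, Complex.sub_im, ← (Complex.le_def.1 (hs _)).2, ← (Complex.le_def.1 (hs _)).2]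
    simp
  obtain ⟨ν, hν⟩ := exists_measure_of_nonneg_on_squares (Complex.reLm ∘ₗ momentFunctional s)
    fun p => (Complex.le_def.1 (hs p)).1
  refine ⟨ν, fun n => ?_⟩
  have h := hν (monomial n 1)
  simp only [eval_monomial, one_mul] at h
  refine ⟨h.1, ?_⟩
  rw [h.2]
  have h1 : momentFunctional s (monomial n 1) = s n := by
    rw [momentFunctional_monomial]; simp
  refine Complex.ext ?_ ?_
  · simp [h1]
  · rw [← h1, him]; simp

/-! ### From positive definite kernels to Hankel matrices -/

/-- Weights on the nodes `0, …, N` that recover the coefficient of order `a ≤ N`: they are the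
columns of an inverse Vandermonde matrix. -/
theorem exists_interpolation_weights (N : ℕ) :
    ∃ U : Fin (N + 1) → Fin (N + 1) → ℝ, ∀ i a : Fin (N + 1),
      ∑ k : Fin (N + 1), (k : ℝ) ^ (i : ℕ) * U k a = if i = a then 1 else 0 := by
  set V := Matrix.vandermonde fun k : Fin (N + 1) => (k : ℝ) with hV
  have hdet : IsUnit V.transpose.det := by
    rw [Matrix.det_transpose, isUnit_iff_ne_zero, hV, Matrix.det_vandermonde_ne_zero_iff]
    intro a b hab
    have hab' : (a : ℝ) = (b : ℝ) := hab
    exact Fin.ext (by exact_mod_cast hab')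
  refine ⟨(V.transpose⁻¹ : Matrix _ _ ℝ), fun i a => ?_⟩
  have h := congrFun (congrFun (Matrix.mul_nonsing_inv V.transpose hdet) i) a
  rw [Matrix.mul_apply, Matrix.one_apply] at h
  simpa [hV, Matrix.vandermonde_apply] using h

/-- With interpolation weights of orders `a` and `b`, the sum of the `n`-th powers of
`u k + v l` vanishes below the order `a + b`. -/
theorem sum_interpolation_weights_pow {N : ℕ} {U : Fin (N + 1) → Fin (N + 1) → ℝ}
    (hU : ∀ i a : Fin (N + 1),
      ∑ k : Fin (N + 1), (k : ℝ) ^ (i : ℕ) * U k a = if i = a then 1 else 0)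
    (u v : ℂ) (a b : Fin (N + 1)) {n : ℕ} (hn : n ≤ a + b) :
    ∑ k : Fin (N + 1), ∑ l : Fin (N + 1), (U k a : ℂ) * U l b * (u * k + v * l) ^ n =
      if n = a + b then u ^ (a : ℕ) * v ^ (b : ℕ) * ((a + b : ℕ).choose a) else 0 := by
  have hM : ∀ (i : ℕ) (a : Fin (N + 1)), i ≤ a →
      ∑ k : Fin (N + 1), (k : ℂ) ^ i * U k a = if i = a then 1 else 0 := by
    intro i a hi
    have h := hU ⟨i, by omega⟩ a
    have h' := congrArg (fun r : ℝ => (r : ℂ)) h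
    simp only [Fin.ext_iff, Complex.ofReal_sum, Complex.ofReal_mul, Complex.ofReal_pow,
      Complex.ofReal_natCast] at h'
    rw [h']
    split_ifs <;> simp
  have hexp : ∑ k : Fin (N + 1), ∑ l : Fin (N + 1), (U k a : ℂ) * U l b * (u * k + v * l) ^ n =
      ∑ i ∈ Finset.range (n + 1), u ^ i * v ^ (n - i) * (n.choose i) *
        ((∑ k : Fin (N + 1), (k : ℂ) ^ i * U k a) *
          ∑ l : Fin (N + 1), (l : ℂ) ^ (n - i) * U l b) := by
    simp_rw [Finset.sum_mul_sum, add_pow, Finset.mul_sum]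
    rw [Finset.sum_comm (s := Finset.range (n + 1))]
    refine Finset.sum_congr rfl fun k _ => ?_
    rw [Finset.sum_comm (s := Finset.range (n + 1))]
    refine Finset.sum_congr rfl fun l _ => Finset.sum_congr rfl fun i _ => ?_
    ring
  rw [hexp]
  have hterm : ∀ i ∈ Finset.range (n + 1), i ≠ a → (∑ k : Fin (N + 1), (k : ℂ) ^ i * U k a) *
          (∑ l : Fin (N + 1), (l : ℂ) ^ (n - i) * U l b) = 0 := by
    intro i hi hia
    rw [Finset.mem_range] at hi
    by_cases h : i < a
    · rw [hM i a h.le, if_neg hia, zero_mul]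
    · rw [hM (n - i) b (by omega), if_neg (by omega), mul_zero]
  split_ifs with h
  · rw [Finset.sum_eq_single (a : ℕ)]
    · have e : n - a = b := by omega
      rw [e, hM a a le_rfl, hM b b le_rfl, h]
      simp
    · intro i hi hia
      rw [hterm i hi hia, mul_zero]
    · intro h'
      exact absurd (Finset.mem_range.2 (by omega)) h'
  · refine Finset.sum_eq_zero fun i hi => ?_
    by_cases hia : i = a
    · subst hia
      rw [Finset.mem_range] at hi
      rw [hM (n - a) b (by omega), if_neg (by omega), mul_zero, mul_zero]
    · rw [hterm i hi hia, mul_zero]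

/-- Taylor's theorem along the real line through `0` in the direction `α`. -/
theorem tendsto_taylor_remainder {g : ℂ → ℂ} (hg : AnalyticAt ℂ g 0) (α : ℂ) (m : ℕ) :
    Filter.Tendsto (fun h : ℝ => (g (h * α) - ∑ n ∈ Finset.range (m + 1),
      iteratedDeriv n g 0 / n.factorial * (h * α) ^ n) / (h : ℂ) ^ m)
      (nhdsWithin 0 (Set.Ioi 0)) (nhds 0) := by
  have h1 := (hg.hasFPowerSeriesAt).isBigO_sub_partialSum_pow (m + 1)
  have h2 : Filter.Tendsto (fun h : ℝ => (h : ℂ) * α) (nhdsWithin 0 (Set.Ioi 0)) (nhds 0) := by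
    have : Continuous fun h : ℝ => (h : ℂ) * α := by fun_prop
    simpa using (this.tendsto 0).mono_left nhdsWithin_le_nhds
  have h3 := h1.comp_tendsto h2
  obtain ⟨c, hc⟩ := h3.bound
  have hlim : Filter.Tendsto (fun h : ℝ => c * ‖α‖ ^ (m + 1) * h)
      (nhdsWithin 0 (Set.Ioi 0)) (nhds 0) := by
    have : Continuous fun h : ℝ => c * ‖α‖ ^ (m + 1) * h := by fun_prop
    simpa using (this.tendsto 0).mono_left nhdsWithin_le_nhds
  refine squeeze_zero_norm' ?_ hlim
  filter_upwards [hc, self_mem_nhdsWithin] with h hh hpos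
  have hpos' : (0 : ℝ) < h := hpos
  rw [norm_div, norm_pow, Complex.norm_real, Real.norm_of_nonneg hpos'.le,
    div_le_iff₀ (by positivity)]
  simp only [Function.comp, zero_add, FormalMultilinearSeries.partialSum,
    FormalMultilinearSeries.ofScalars_apply_eq, norm_pow, norm_norm, norm_mul, Complex.norm_real,
    Real.norm_of_nonneg hpos'.le, smul_eq_mul] at hh
  calc _ ≤ _ := hh
    _ = _ := by ring

/-- The divided difference of order `(a, b)` of `(x, y) ↦ g (u x + v y)`, over a grid at the origin
whose mesh `h` tends to `0`, converges to the Taylor coefficient of that order. -/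
theorem tendsto_mixed_difference_quotient {g : ℂ → ℂ} (hg : AnalyticAt ℂ g 0) {N : ℕ}
    {U : Fin (N + 1) → Fin (N + 1) → ℝ}
    (hU : ∀ i a : Fin (N + 1),
      ∑ k : Fin (N + 1), (k : ℝ) ^ (i : ℕ) * U k a = if i = a then 1 else 0)
    (u v : ℂ) (a b : Fin (N + 1)) :
    Filter.Tendsto (fun h : ℝ => (∑ k : Fin (N + 1), ∑ l : Fin (N + 1),
        (U k a : ℂ) * U l b * g (h * (u * k + v * l))) / (h : ℂ) ^ (a + b : ℕ))
      (nhdsWithin 0 (Set.Ioi 0))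
      (nhds (u ^ (a : ℕ) * v ^ (b : ℕ) * iteratedDeriv (a + b) g 0 /
        ((a : ℕ).factorial * (b : ℕ).factorial))) := by
  set m : ℕ := a + b with hm
  have hR : Filter.Tendsto (fun h : ℝ => ∑ k : Fin (N + 1), ∑ l : Fin (N + 1),
      (U k a : ℂ) * U l b * ((g (h * (u * k + v * l)) - ∑ n ∈ Finset.range (m + 1),
      iteratedDeriv n g 0 / n.factorial * (h * (u * k + v * l)) ^ n) / (h : ℂ) ^ m))
      (nhdsWithin 0 (Set.Ioi 0)) (nhds 0) := by
    have := tendsto_finsetSum Finset.univ fun (k : Fin (N + 1)) _ =>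
      tendsto_finsetSum Finset.univ fun (l : Fin (N + 1)) _ =>
        (tendsto_taylor_remainder hg (u * k + v * l) m).const_mul ((U k a : ℂ) * U l b)
    simpa only [mul_zero, Finset.sum_const_zero] using this
  have hR' := hR.add_const (u ^ (a : ℕ) * v ^ (b : ℕ) * iteratedDeriv m g 0 /
        ((a : ℕ).factorial * (b : ℕ).factorial))
  rw [zero_add] at hR'
  refine hR'.congr' ?_
  filter_upwards [self_mem_nhdsWithin] with h hpos
  have hh : (h : ℂ) ≠ 0 := by exact_mod_cast (ne_of_gt (show (0 : ℝ) < h from hpos))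
  have hpoly : ∑ k : Fin (N + 1), ∑ l : Fin (N + 1), (U k a : ℂ) * U l b *
      ((∑ n ∈ Finset.range (m + 1),
      iteratedDeriv n g 0 / n.factorial * (h * (u * k + v * l)) ^ n) / (h : ℂ) ^ m) =
      u ^ (a : ℕ) * v ^ (b : ℕ) * iteratedDeriv m g 0 /
        ((a : ℕ).factorial * (b : ℕ).factorial) := by
    have h1 : ∑ k : Fin (N + 1), ∑ l : Fin (N + 1), (U k a : ℂ) * U l b *
      ((∑ n ∈ Finset.range (m + 1),
      iteratedDeriv n g 0 / n.factorial * (h * (u * k + v * l)) ^ n) / (h : ℂ) ^ m) =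
      ∑ n ∈ Finset.range (m + 1), iteratedDeriv n g 0 / n.factorial * (h ^ n / h ^ m) *
        ∑ k : Fin (N + 1), ∑ l : Fin (N + 1), (U k a : ℂ) * U l b * (u * k + v * l) ^ n := by
      simp_rw [Finset.sum_div, Finset.mul_sum]
      rw [Finset.sum_comm (s := Finset.range (m + 1))]
      refine Finset.sum_congr rfl fun k _ => ?_
      rw [Finset.sum_comm (s := Finset.range (m + 1))]
      refine Finset.sum_congr rfl fun l _ => Finset.sum_congr rfl fun i _ => ?_
      rw [mul_pow]
      ring
    rw [h1, Finset.sum_eq_single m]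
    · rw [sum_interpolation_weights_pow hU u v a b le_rfl, if_pos rfl,
        Nat.cast_add_choose, ← hm, div_self (pow_ne_zero m hh)]
      have h1 : (m.factorial : ℂ) ≠ 0 := by exact_mod_cast m.factorial_ne_zero
      field_simp
    · intro n hn hnm
      rw [Finset.mem_range] at hn
      rw [sum_interpolation_weights_pow hU u v a b (by omega), if_neg hnm, mul_zero]
    · simp
  rw [← hpoly, Finset.sum_div, ← Finset.sum_add_distrib]
  refine Finset.sum_congr rfl fun k _ => ?_
  rw [Finset.sum_div, ← Finset.sum_add_distrib]
  refine Finset.sum_congr rfl fun l _ => ?_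
  ring

theorem sum_sum_comm_sum_sum {ι κ M : Type*} [Fintype ι] [Fintype κ] [AddCommMonoid M]
    (F : ι → ι → κ → κ → M) :
    ∑ a, ∑ b, ∑ k, ∑ l, F a b k l = ∑ k, ∑ l, ∑ a, ∑ b, F a b k l := by
  simp_rw [Finset.sum_comm (s := (Finset.univ : Finset ι)) (t := (Finset.univ : Finset κ))]

/-- If the kernel `g (w x - conj (w y))` is positive definite for small real `x, y`, then the
sequence `(-i)ⁿ g⁽ⁿ⁾(0)` has positive semidefinite Hankel matrices. -/
theorem hankel_nonneg_of_local_posDef {g : ℂ → ℂ} (hg : AnalyticAt ℂ g 0) {w : ℂ} (hw : w ≠ 0)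
    {δ : ℝ} (hδ : 0 < δ)
    (hpd : ∀ (n : ℕ) (x : Fin n → ℝ) (ξ : Fin n → ℂ), (∀ k, |x k| < δ) →
      0 ≤ ∑ k, ∑ l, g (w * x k - starRingEnd ℂ (w * x l)) * ξ k * starRingEnd ℂ (ξ l))
    (N : ℕ) (d : Fin (N + 1) → ℝ) :
    0 ≤ ∑ a : Fin (N + 1), ∑ b : Fin (N + 1),
      (-Complex.I) ^ (a + b : ℕ) * iteratedDeriv (a + b) g 0 * d a * d b := by
  obtain ⟨U, hU⟩ := exists_interpolation_weights N
  -- with these weights `∑ k, ξ h k * exp (i w (h k) t)` tends to `∑ a, d a * t ^ a` as `h → 0`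
  let e : Fin (N + 1) → ℂ := fun a => (a : ℕ).factorial * ((-Complex.I) ^ (a : ℕ) * d a)
  let ξ : ℝ → Fin (N + 1) → ℂ := fun h k => ∑ a, U k a * (e a / (w * h) ^ (a : ℕ))
  have hw' : starRingEnd ℂ w ≠ 0 := by simpa using hw
  have hlim : Filter.Tendsto (fun h : ℝ => ∑ k : Fin (N + 1), ∑ l : Fin (N + 1),
      g (w * ((h * (k : ℕ) : ℝ) : ℂ) - starRingEnd ℂ (w * ((h * (l : ℕ) : ℝ) : ℂ))) *
        ξ h k * starRingEnd ℂ (ξ h l)) (nhdsWithin 0 (Set.Ioi 0))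
      (nhds (∑ a : Fin (N + 1), ∑ b : Fin (N + 1),
      (-Complex.I) ^ (a + b : ℕ) * iteratedDeriv (a + b) g 0 * d a * d b)) := by
    have h1 : Filter.Tendsto (fun h : ℝ => ∑ a : Fin (N + 1), ∑ b : Fin (N + 1),
        e a / w ^ (a : ℕ) * (starRingEnd ℂ (e b) / (starRingEnd ℂ w) ^ (b : ℕ)) *
        ((∑ k : Fin (N + 1), ∑ l : Fin (N + 1),
        (U k a : ℂ) * U l b * g (h * (w * k + -starRingEnd ℂ w * l))) / (h : ℂ) ^ (a + b : ℕ)))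
        (nhdsWithin 0 (Set.Ioi 0)) (nhds (∑ a : Fin (N + 1), ∑ b : Fin (N + 1),
        e a / w ^ (a : ℕ) * (starRingEnd ℂ (e b) / (starRingEnd ℂ w) ^ (b : ℕ)) *
        (w ^ (a : ℕ) * (-starRingEnd ℂ w) ^ (b : ℕ) * iteratedDeriv (a + b) g 0 /
        ((a : ℕ).factorial * (b : ℕ).factorial)))) :=
      tendsto_finsetSum _ fun a _ => tendsto_finsetSum _ fun b _ =>
        (tendsto_mixed_difference_quotient hg hU w (-starRingEnd ℂ w) a b).const_mul _
    have h2 : ∀ a b : Fin (N + 1),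
        e a / w ^ (a : ℕ) * (starRingEnd ℂ (e b) / (starRingEnd ℂ w) ^ (b : ℕ)) *
        (w ^ (a : ℕ) * (-starRingEnd ℂ w) ^ (b : ℕ) * iteratedDeriv (a + b) g 0 /
        ((a : ℕ).factorial * (b : ℕ).factorial)) =
        (-Complex.I) ^ (a + b : ℕ) * iteratedDeriv (a + b) g 0 * d a * d b := by
      intro a b
      have ha : ((a : ℕ).factorial : ℂ) ≠ 0 := by exact_mod_cast (a : ℕ).factorial_ne_zero
      have hb : ((b : ℕ).factorial : ℂ) ≠ 0 := by exact_mod_cast (b : ℕ).factorial_ne_zero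
      have hI : (-Complex.I) ^ (b : ℕ) = Complex.I ^ (b : ℕ) * (-1) ^ (b : ℕ) := by
        rw [← mul_pow]; ring
      simp only [e, map_mul, map_pow, map_neg, Complex.conj_I, neg_neg, Complex.conj_ofReal,
        map_natCast]
      rw [pow_add, hI, neg_pow (starRingEnd ℂ w)]
      field_simp
    simp_rw [h2] at h1
    refine h1.congr' ?_
    filter_upwards [self_mem_nhdsWithin] with h hpos
    have hh : (h : ℂ) ≠ 0 := by exact_mod_cast (ne_of_gt (show (0 : ℝ) < h from hpos))
    have h3 : ∀ k l : Fin (N + 1), w * ((h * (k : ℕ) : ℝ) : ℂ) -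
        starRingEnd ℂ (w * ((h * (l : ℕ) : ℝ) : ℂ)) =
        h * (w * k + -starRingEnd ℂ w * l) := by
      intro k l
      simp only [map_mul, Complex.conj_ofReal]
      push_cast
      ring
    simp_rw [h3, ξ, map_sum, map_mul, map_div₀, map_pow, map_mul, Complex.conj_ofReal,
      mul_assoc (g _), Finset.sum_mul_sum, Finset.mul_sum, Finset.sum_div, Finset.mul_sum]
    rw [sum_sum_comm_sum_sum]
    refine Finset.sum_congr rfl fun k _ => Finset.sum_congr rfl fun l _ =>
      Finset.sum_congr rfl fun a _ => Finset.sum_congr rfl fun b _ => ?_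
    rw [mul_pow, mul_pow, pow_add]
    have hwa := pow_ne_zero (a : ℕ) hw
    have hwb := pow_ne_zero (b : ℕ) hw'
    field_simp
  refine ge_of_tendsto hlim ?_
  have hsmall : ∀ᶠ h : ℝ in nhdsWithin 0 (Set.Ioi 0), h * (N + 1) < δ := by
    have : Continuous fun h : ℝ => h * (N + 1 : ℝ) := by fun_prop
    have := (this.tendsto 0).mono_left (nhdsWithin_le_nhds (s := Set.Ioi 0))
    simp only [zero_mul] at this
    exact this.eventually (gt_mem_nhds hδ)
  filter_upwards [hsmall, self_mem_nhdsWithin] with h hh hpos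
  have hpos' : (0 : ℝ) < h := hpos
  refine hpd (N + 1) (fun k => h * (k : ℕ)) (ξ h) fun k => ?_
  rw [abs_of_nonneg (by positivity)]
  refine lt_of_le_of_lt ?_ hh
  gcongr
  have : (k : ℕ) ≤ N + 1 := by omega
  exact_mod_cast this

/-! ### Exponential tilts -/

/-- The exponential tilt `e^{ct} dμ(t)`, without normalisation. -/
noncomputable def expTilt (μ : Measure ℝ) (c : ℝ) : Measure ℝ :=
  μ.withDensity fun t => ENNReal.ofReal (Real.exp (c * t))

theorem measurable_ofReal_exp_mul (c : ℝ) :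
    Measurable fun t : ℝ => ENNReal.ofReal (Real.exp (c * t)) := by fun_prop

theorem integrable_expTilt_iff {E : Type*} [NormedAddCommGroup E] [NormedSpace ℝ E]
    {μ : Measure ℝ} {c : ℝ} {g : ℝ → E} :
    Integrable g (expTilt μ c) ↔ Integrable (fun t => Real.exp (c * t) • g t) μ := by
  rw [expTilt, integrable_withDensity_iff_integrable_smul' (measurable_ofReal_exp_mul c)
    (ae_of_all _ fun _ => ENNReal.ofReal_lt_top)]
  simp_rw [ENNReal.toReal_ofReal (Real.exp_pos _).le]

theorem integral_expTilt {E : Type*} [NormedAddCommGroup E] [NormedSpace ℝ E]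
    (μ : Measure ℝ) (c : ℝ) (g : ℝ → E) :
    ∫ t, g t ∂(expTilt μ c) = ∫ t, Real.exp (c * t) • g t ∂μ := by
  rw [expTilt, integral_withDensity_eq_integral_toReal_smul (measurable_ofReal_exp_mul c)
    (ae_of_all _ fun _ => ENNReal.ofReal_lt_top)]
  simp_rw [ENNReal.toReal_ofReal (Real.exp_pos _).le]

theorem expTilt_expTilt_neg (μ : Measure ℝ) (c : ℝ) : expTilt (expTilt μ c) (-c) = μ := by
  rw [expTilt, expTilt,
    ← withDensity_mul _ (measurable_ofReal_exp_mul c) (measurable_ofReal_exp_mul (-c))]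
  have h : ((fun t : ℝ => ENNReal.ofReal (Real.exp (c * t))) *
      fun t : ℝ => ENNReal.ofReal (Real.exp (-c * t))) = 1 := by
    funext t
    rw [Pi.mul_apply, ← ENNReal.ofReal_mul (Real.exp_pos _).le, ← Real.exp_add]
    simp
  rw [h, withDensity_one]

theorem isFiniteMeasure_expTilt {μ : Measure ℝ} {c : ℝ}
    (h : Integrable (fun t => Real.exp (c * t)) μ) : IsFiniteMeasure (expTilt μ c) :=
  isFiniteMeasure_withDensity h.lintegral_lt_top.ne

theorem isLocallyFiniteMeasure_expTilt {μ : Measure ℝ} [IsLocallyFiniteMeasure μ] (c : ℝ) :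
    IsLocallyFiniteMeasure (expTilt μ c) :=
  IsLocallyFiniteMeasure.withDensity_ofReal (by fun_prop)

/-! ### Fourier–Laplace integrals and their derivatives -/

/-- The interior of the set of `u` for which `∫ e^{-ut} dμ(t)` converges. -/
def expDomain (μ : Measure ℝ) : Set ℝ :=
  Neg.neg ⁻¹' interior (ProbabilityTheory.integrableExpSet id μ)

theorem isOpen_expDomain (μ : Measure ℝ) : IsOpen (expDomain μ) :=
  isOpen_interior.preimage continuous_neg

theorem convex_expDomain (μ : Measure ℝ) : Convex ℝ (expDomain μ) :=
  ProbabilityTheory.convex_integrableExpSet.interior.linear_preimage (-LinearMap.id)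

theorem subset_expDomain {μ : Measure ℝ} {J : Set ℝ} (hJ : IsOpen J)
    (h : ∀ u ∈ J, Integrable (fun t => Real.exp (-(u * t))) μ) : J ⊆ expDomain μ := by
  intro u hu
  refine mem_interior.2 ⟨Neg.neg ⁻¹' J, fun v hv => ?_, hJ.preimage continuous_neg, by simpa⟩
  have := h (-v) hv
  simpa [ProbabilityTheory.integrableExpSet] using this

theorem integrable_exp_of_mem_expDomain {μ : Measure ℝ} {u : ℝ} (hu : u ∈ expDomain μ) :
    Integrable (fun t => Real.exp (-(u * t))) μ := by
  have := interior_subset hu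
  simpa [ProbabilityTheory.integrableExpSet] using this

theorem integrable_pow_mul_cexp {μ : Measure ℝ} {z : ℂ} (hz : z.im ∈ expDomain μ) (n : ℕ) :
    Integrable (fun t : ℝ => (Complex.I * t) ^ n * Complex.exp (Complex.I * t * z)) μ := by
  have hz' : (Complex.I * z).re ∈ interior (ProbabilityTheory.integrableExpSet id μ) := by
    simpa [expDomain] using hz
  have h := (ProbabilityTheory.integrable_pow_mul_cexp_of_re_mem_interior_integrableExpSet
    hz' n).const_mul (Complex.I ^ n)
  refine h.congr (ae_of_all _ fun t => ?_)
  simp only [id]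
  rw [mul_right_comm Complex.I z, mul_pow, ← mul_assoc]

/-- Differentiation under the integral sign. -/
theorem hasDerivAt_integral_pow_mul_cexp {μ : Measure ℝ} {z : ℂ} (hz : z.im ∈ expDomain μ)
    (n : ℕ) :
    HasDerivAt (fun z : ℂ => ∫ t : ℝ, (Complex.I * t) ^ n * Complex.exp (Complex.I * t * z) ∂μ)
      (∫ t : ℝ, (Complex.I * t) ^ (n + 1) * Complex.exp (Complex.I * t * z) ∂μ) z := by
  have hz' : (Complex.I * z).re ∈ interior (ProbabilityTheory.integrableExpSet id μ) := by
    simpa [expDomain] using hz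
  have h1 := ProbabilityTheory.hasDerivAt_integral_pow_mul_exp hz' n
  have h2 : HasDerivAt (fun z : ℂ => Complex.I * z) Complex.I z := by
    simpa using (hasDerivAt_id z).const_mul Complex.I
  have h3 := (h1.comp z h2).const_mul (Complex.I ^ n)
  have key : ∀ (m : ℕ) (w : ℂ),
      ∫ t : ℝ, (Complex.I * t) ^ m * Complex.exp (Complex.I * t * w) ∂μ =
      Complex.I ^ m * ∫ t : ℝ, (t : ℂ) ^ m * Complex.exp (Complex.I * w * t) ∂μ := by
    intro m w
    rw [← integral_const_mul]
    congr with t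
    rw [mul_right_comm Complex.I w, mul_pow, mul_assoc]
  simp_rw [key]
  refine h3.congr_deriv ?_
  rw [pow_succ]
  simp only [id]
  ring

theorem iteratedDeriv_integral_cexp {μ : Measure ℝ} {z : ℂ} (hz : z.im ∈ expDomain μ) (n : ℕ) :
    iteratedDeriv n (fun z : ℂ => ∫ t : ℝ, Complex.exp (Complex.I * t * z) ∂μ) z =
      ∫ t : ℝ, (Complex.I * t) ^ n * Complex.exp (Complex.I * t * z) ∂μ := by
  induction n generalizing z with
  | zero => simp
  | succ n ih =>
    rw [iteratedDeriv_succ]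
    refine HasDerivAt.deriv ?_
    refine (hasDerivAt_integral_pow_mul_cexp hz n).congr_of_eventuallyEq ?_
    filter_upwards [((isOpen_expDomain μ).preimage Complex.continuous_im).mem_nhds hz] with w hw
      using ih hw

theorem differentiableOn_integral_cexp (μ : Measure ℝ) :
    DifferentiableOn ℂ (fun z : ℂ => ∫ t : ℝ, Complex.exp (Complex.I * t * z) ∂μ)
      (Complex.im ⁻¹' expDomain μ) := by
  intro z hz
  have := hasDerivAt_integral_pow_mul_cexp (show z.im ∈ expDomain μ from hz) 0
  simp only [pow_zero, one_mul] at this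
  exact this.differentiableAt.differentiableWithinAt

/-- At the point `ic` the kernel `e^{itz}` is the real exponential `e^{-ct}`. -/
theorem cexp_I_mul_I_mul (t c : ℝ) :
    Complex.exp (Complex.I * t * (Complex.I * c)) = (Real.exp (-(c * t)) : ℂ) := by
  have : Complex.I * t * (Complex.I * c) = ((-(c * t) : ℝ) : ℂ) := by
    push_cast
    linear_combination (t * c : ℂ) * Complex.I_mul_I
  rw [this, Complex.ofReal_exp]

theorem integrable_pow_mul_exp {μ : Measure ℝ} {c : ℝ} (hc : c ∈ expDomain μ) (n : ℕ) :
    Integrable (fun t : ℝ => t ^ n * Real.exp (-(c * t))) μ := by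
  have := ProbabilityTheory.integrable_pow_mul_exp_of_mem_interior_integrableExpSet
    (X := id) (μ := μ) (v := -c) hc n
  simpa using this

/-- The integral of `(it)ⁿ e^{itz}` at a point `z = ic` of the imaginary axis is a real moment. -/
theorem integral_pow_mul_cexp_I_mul (μ : Measure ℝ) (c : ℝ) (n : ℕ) :
    ∫ t : ℝ, (Complex.I * t) ^ n * Complex.exp (Complex.I * t * (Complex.I * c)) ∂μ =
      Complex.I ^ n * ((∫ t : ℝ, t ^ n * Real.exp (-(c * t)) ∂μ : ℝ) : ℂ) := by
  rw [← integral_complex_ofReal, ← integral_const_mul]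
  congr with t
  rw [cexp_I_mul_I_mul]
  push_cast
  ring

/-! ### Convergence and analytic continuation from moments -/

theorem exp_le_two_mul_cosh (ρ c u t : ℝ) (h : |u - c| = ρ) :
    Real.exp (-(u * t)) ≤ 2 * (Real.cosh (ρ * t) * Real.exp (-(c * t))) := by
  have h1 : Real.exp (-(u * t)) = Real.exp (-((u - c) * t)) * Real.exp (-(c * t)) := by
    rw [← Real.exp_add]; ring_nf
  have h2 : Real.cosh (ρ * t) = Real.cosh ((u - c) * t) := by
    rw [← h]
    rcases abs_choice (u - c) with h | h <;> rw [h]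
    rw [neg_mul, Real.cosh_neg]
  rw [h1, h2, ← mul_assoc]
  gcongr
  rw [Real.cosh_eq]
  have := Real.exp_pos ((u - c) * t)
  linarith

/-- If the tilted moments `∫ tⁿ e^{-ct} dμ(t)` are, up to powers of `i`, the derivatives at `ic` of
a function holomorphic on a disc about `ic`, then `∫ e^{-ut} dμ(t)` converges whenever `iu` lies in
that disc: the even part of the Taylor series is, up to signs, the termwise integral of the `cosh`
series, whose terms are non-negative. -/
theorem integrable_exp_of_moments {f : ℂ → ℂ} {μ : Measure ℝ} {c r : ℝ}
    (hf : DifferentiableOn ℂ f (Metric.ball (Complex.I * c) r))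
    (hint : ∀ n : ℕ, Integrable (fun t : ℝ => t ^ n * Real.exp (-(c * t))) μ)
    (hmom : ∀ n : ℕ, iteratedDeriv n f (Complex.I * c) =
      Complex.I ^ n * ((∫ t : ℝ, t ^ n * Real.exp (-(c * t)) ∂μ : ℝ) : ℂ))
    {u : ℝ} (hu : |u - c| < r) : Integrable (fun t => Real.exp (-(u * t))) μ := by
  set ρ := |u - c| with hρ
  have hρ0 : 0 ≤ ρ := abs_nonneg _
  have hz : Complex.I * c + ρ ∈ Metric.ball (Complex.I * c) r := by
    rw [mem_ball_iff_norm, add_sub_cancel_left, Complex.norm_real, Real.norm_of_nonneg hρ0]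
    exact hu
  have hsum := (Complex.hasSum_taylorSeries_on_ball hf hz).summable.norm
  set M : ℕ → ℝ := fun n => ∫ t : ℝ, t ^ n * Real.exp (-(c * t)) ∂μ with hM
  have hMnn : ∀ n, 0 ≤ M (2 * n) := fun n => integral_nonneg fun t => by
    have : 0 ≤ t ^ (2 * n) := by rw [pow_mul]; positivity
    positivity
  have hsum2 : Summable fun n => ρ ^ (2 * n) / (2 * n).factorial * M (2 * n) := by
    refine (hsum.comp_injective (mul_right_injective₀ (two_ne_zero (α := ℕ)))).congr fun n => ?_
    simp only [Function.comp, hmom, add_sub_cancel_left, norm_smul, norm_inv, norm_pow, norm_mul,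
      Complex.norm_real, Complex.norm_I, one_pow, one_mul, Complex.norm_natCast,
      Real.norm_of_nonneg hρ0]
    rw [Real.norm_of_nonneg (hMnn n)]
    ring
  have hterm : ∀ (n : ℕ) (t : ℝ),
      0 ≤ (ρ * t) ^ (2 * n) / (2 * n).factorial * Real.exp (-(c * t)) := by
    intro n t
    have : 0 ≤ (ρ * t) ^ (2 * n) := by rw [pow_mul]; positivity
    positivity
  have hcosh : Integrable (fun t => Real.cosh (ρ * t) * Real.exp (-(c * t))) μ := by
    refine (lintegral_ofReal_ne_top_iff_integrable (by fun_prop)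
      (ae_of_all _ fun t => by positivity)).1 ?_
    have h1 : ∀ t, ENNReal.ofReal (Real.cosh (ρ * t) * Real.exp (-(c * t))) =
        ∑' n : ℕ, ENNReal.ofReal
          ((ρ * t) ^ (2 * n) / (2 * n).factorial * Real.exp (-(c * t))) := by
      intro t
      have h := (Real.hasSum_cosh (ρ * t)).mul_right (Real.exp (-(c * t)))
      rw [← h.tsum_eq, ENNReal.ofReal_tsum_of_nonneg (fun n => hterm n t) h.summable]
    simp_rw [h1]
    rw [lintegral_tsum fun n => by fun_prop]
    have h2 : ∀ n : ℕ, ∫⁻ t, ENNReal.ofReal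
          ((ρ * t) ^ (2 * n) / (2 * n).factorial * Real.exp (-(c * t))) ∂μ =
        ENNReal.ofReal (ρ ^ (2 * n) / (2 * n).factorial * M (2 * n)) := by
      intro n
      have e : ∀ t : ℝ, (ρ * t) ^ (2 * n) / (2 * n).factorial * Real.exp (-(c * t)) =
          ρ ^ (2 * n) / (2 * n).factorial * (t ^ (2 * n) * Real.exp (-(c * t))) := by
        intro t; rw [mul_pow]; ring
      rw [hM, ← integral_const_mul, ← ofReal_integral_eq_lintegral_ofReal]
      · simp_rw [e]
      · simp_rw [e]
        exact (hint _).const_mul _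
      · exact ae_of_all _ (hterm n)
    simp_rw [h2]
    exact hsum2.tsum_ofReal_ne_top
  refine (hcosh.const_mul 2).mono' (by fun_prop) (ae_of_all _ fun t => ?_)
  rw [Real.norm_of_nonneg (Real.exp_pos _).le]
  exact exp_le_two_mul_cosh ρ c u t hρ.symm

theorem mem_ball_of_im_sub {c r : ℝ} {z : ℂ} (hz : z ∈ Metric.ball (Complex.I * c) r) :
    |z.im - c| < r := by
  rw [mem_ball_iff_norm] at hz
  refine lt_of_le_of_lt ?_ hz
  simpa using Complex.abs_im_le_norm (z - Complex.I * c)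

/-- **Local-to-global principle.** If at one point `iy` the derivatives of a function holomorphic
on a strip are, up to powers of `i`, the tilted moments of a measure, then the Fourier–Laplace
integral of the measure converges and represents the function on the whole strip. -/
theorem fourierLaplace_of_moments {f : ℂ → ℂ} {J : Set ℝ} (hJo : IsOpen J) (hJc : Convex ℝ J)
    (hf : DifferentiableOn ℂ f (Complex.im ⁻¹' J)) {μ : Measure ℝ} {y : ℝ} (hy : y ∈ J)
    (hint : ∀ n : ℕ, Integrable (fun t : ℝ => t ^ n * Real.exp (-(y * t))) μ)
    (hmom : ∀ n : ℕ, iteratedDeriv n f (Complex.I * y) =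
      Complex.I ^ n * ((∫ t : ℝ, t ^ n * Real.exp (-(y * t)) ∂μ : ℝ) : ℂ)) :
    J ⊆ expDomain μ ∧
      ∀ z : ℂ, z.im ∈ J → f z = ∫ t : ℝ, Complex.exp (Complex.I * t * z) ∂μ := by
  have hball : ∀ c r : ℝ, Metric.ball c r ⊆ J →
      Metric.ball (Complex.I * c) r ⊆ Complex.im ⁻¹' J := fun c r h z hz =>
    h (by simpa [Real.dist_eq] using mem_ball_of_im_sub hz)
  have hext : ∀ c r : ℝ, Metric.ball c r ⊆ J →
      (∀ n : ℕ, Integrable (fun t : ℝ => t ^ n * Real.exp (-(c * t))) μ) →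
      (∀ n : ℕ, iteratedDeriv n f (Complex.I * c) =
        Complex.I ^ n * ((∫ t : ℝ, t ^ n * Real.exp (-(c * t)) ∂μ : ℝ) : ℂ)) →
      Metric.ball c r ⊆ expDomain μ := fun c r h hi hm =>
    subset_expDomain Metric.isOpen_ball fun u hu =>
      integrable_exp_of_moments (hf.mono (hball c r h)) hi hm
        (by simpa [Real.dist_eq] using hu)
  obtain ⟨r, hr, hrJ⟩ := Metric.isOpen_iff.1 hJo y hy
  have hyr := hext y r hrJ hint hmom
  have hyK : y ∈ expDomain μ := hyr (Metric.mem_ball_self hr)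
  set F : ℂ → ℂ := fun z => ∫ t : ℝ, Complex.exp (Complex.I * t * z) ∂μ with hF
  have hFder : ∀ c ∈ expDomain μ, ∀ n : ℕ, iteratedDeriv n F (Complex.I * c) =
      Complex.I ^ n * ((∫ t : ℝ, t ^ n * Real.exp (-(c * t)) ∂μ : ℝ) : ℂ) := by
    intro c hc n
    rw [hF, iteratedDeriv_integral_cexp (by simpa using hc), integral_pow_mul_cexp_I_mul]
  have hFdiff : DifferentiableOn ℂ F (Complex.im ⁻¹' expDomain μ) :=
    differentiableOn_integral_cexp μ
  have hlocal : Set.EqOn f F (Metric.ball (Complex.I * y) r) := by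
    intro z hz
    have h1 := Complex.hasSum_taylorSeries_on_ball (hf.mono (hball y r hrJ)) hz
    have h2 := Complex.hasSum_taylorSeries_on_ball (hFdiff.mono fun w hw =>
      hyr (by simpa [Real.dist_eq] using mem_ball_of_im_sub hw)) hz
    simp_rw [hmom] at h1
    simp_rw [hFder y hyK] at h2
    exact h1.unique h2
  have hopen : ∀ K : Set ℝ, IsOpen K → IsOpen (Complex.im ⁻¹' K) := fun K hK =>
    hK.preimage Complex.continuous_im
  have heq : Set.EqOn f F (Complex.im ⁻¹' (J ∩ expDomain μ)) := by
    refine AnalyticOnNhd.eqOn_of_preconnected_of_eventuallyEq (z₀ := Complex.I * y)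
      ((hf.mono fun z hz => hz.1).analyticOnNhd (hopen _ (hJo.inter (isOpen_expDomain μ))))
      ((hFdiff.mono fun z hz => hz.2).analyticOnNhd (hopen _ (hJo.inter (isOpen_expDomain μ))))
      ((hJc.inter (convex_expDomain μ)).linear_preimage Complex.imLm).isPreconnected ?_ ?_
    · simpa using ⟨hy, hyK⟩
    · filter_upwards [Metric.ball_mem_nhds _ hr] with z hz using hlocal hz
  have hsub : J ⊆ expDomain μ := by
    refine hJc.isPreconnected.subset_of_closure_inter_subset (isOpen_expDomain μ)
      ⟨y, hy, hyK⟩ ?_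
    rintro c ⟨hc, hcJ⟩
    -- a ball about a nearby point of the domain, with radius `ε / 2`, already contains `c`
    obtain ⟨ε, hε, hεJ⟩ := Metric.isOpen_iff.1 hJo c hcJ
    obtain ⟨c', hc'K, hc'⟩ := Metric.mem_closure_iff.1 hc (ε / 2) (half_pos hε)
    have hc'J : Metric.ball c' (ε / 2) ⊆ J := by
      refine (Metric.ball_subset ?_).trans hεJ
      rw [dist_comm]
      linarith
    have hc'mem : c' ∈ J := hc'J (Metric.mem_ball_self (half_pos hε))
    refine hext c' (ε / 2) hc'J (integrable_pow_mul_exp hc'K) (fun n => ?_) hc'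
    rw [← hFder c' hc'K n]
    refine Filter.EventuallyEq.iteratedDeriv_eq n ?_
    have hnhds : Complex.im ⁻¹' (J ∩ expDomain μ) ∈ nhds (Complex.I * c') :=
      (hopen _ (hJo.inter (isOpen_expDomain μ))).mem_nhds (by simpa using ⟨hc'mem, hc'K⟩)
    filter_upwards [hnhds] with z hz using heq hz
  exact ⟨hsub, fun z hz => heq ⟨hz, hsub hz⟩⟩

open Polynomial in
/-- A function holomorphic on a strip whose kernel `f (iy + w x - conj (w x'))` is positive definite
for small real `x, x'` is the Fourier–Laplace transform of a measure. -/
theorem exists_measure_of_local_posDef {f : ℂ → ℂ} {J : Set ℝ} (hJo : IsOpen J)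
    (hJc : Convex ℝ J) (hf : DifferentiableOn ℂ f (Complex.im ⁻¹' J)) {y : ℝ} (hy : y ∈ J)
    {w : ℂ} (hw : w ≠ 0) {δ : ℝ} (hδ : 0 < δ)
    (hpd : ∀ (n : ℕ) (x : Fin n → ℝ) (ξ : Fin n → ℂ), (∀ k, |x k| < δ) →
      0 ≤ ∑ k, ∑ l, f (Complex.I * y + (w * x k - starRingEnd ℂ (w * x l))) * ξ k *
        starRingEnd ℂ (ξ l)) :
    ∃ μ : Measure ℝ, IsLocallyFiniteMeasure μ ∧ J ⊆ expDomain μ ∧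
      ∀ z : ℂ, z.im ∈ J → f z = ∫ t : ℝ, Complex.exp (Complex.I * t * z) ∂μ := by
  have hfy : AnalyticAt ℂ f (Complex.I * y) :=
    hf.analyticAt ((hJo.preimage Complex.continuous_im).mem_nhds (by simpa using hy))
  set g : ℂ → ℂ := fun z => f (Complex.I * y + z) with hg
  have hg0 : AnalyticAt ℂ g 0 := by
    refine AnalyticAt.fun_comp (g := f) (f := fun z => Complex.I * y + z) ?_ (by fun_prop)
    simpa using hfy
  have hgder : ∀ n, iteratedDeriv n g 0 = iteratedDeriv n f (Complex.I * y) := by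
    intro n
    rw [hg, iteratedDeriv_comp_const_add]
    simp
  obtain ⟨ν, hν⟩ := exists_measure_of_momentFunctional_nonneg
    (fun n => (-Complex.I) ^ n * iteratedDeriv n g 0) fun p => by
      rw [momentFunctional_mul_self]
      exact hankel_nonneg_of_local_posDef hg0 hw hδ hpd p.natDegree fun a => p.coeff a
  have hexp : ∀ t : ℝ, Real.exp (y * t) * Real.exp (-(y * t)) = 1 := by
    intro t; rw [← Real.exp_add]; simp
  have hνfin : IsFiniteMeasure ν := by
    have := (hν 0).1
    simp only [pow_zero] at this
    exact (integrable_const_iff_isFiniteMeasure one_ne_zero).1 this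
  have hcancel : ∀ (n : ℕ) (t : ℝ),
      Real.exp (y * t) • (t ^ n * Real.exp (-(y * t))) = t ^ n := by
    intro n t
    rw [smul_eq_mul, mul_left_comm, hexp, mul_one]
  refine ⟨expTilt ν y, isLocallyFiniteMeasure_expTilt y,
    fourierLaplace_of_moments hJo hJc hf hy (fun n => ?_) (fun n => ?_)⟩
  · rw [integrable_expTilt_iff]
    simp_rw [hcancel]
    exact (hν n).1
  · rw [integral_expTilt]
    simp_rw [hcancel]
    rw [← (hν n).2, hgder, ← mul_assoc, ← mul_pow]
    simp

/-! ### Positivity of the transforms -/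

/-- Gram matrices of functions are positive semidefinite. -/
theorem sum_integral_mul_conj_nonneg {μ : Measure ℝ} {n : ℕ} {φ : Fin n → ℝ → ℂ}
    (h : ∀ k l, Integrable (fun t => φ k t * starRingEnd ℂ (φ l t)) μ) (ξ : Fin n → ℂ) :
    0 ≤ ∑ k, ∑ l, (∫ t, φ k t * starRingEnd ℂ (φ l t) ∂μ) * ξ k * starRingEnd ℂ (ξ l) := by
  have h1 : ∑ k, ∑ l, (∫ t, φ k t * starRingEnd ℂ (φ l t) ∂μ) * ξ k * starRingEnd ℂ (ξ l) =
      ∫ t, ((Complex.normSq (∑ k, φ k t * ξ k) : ℝ) : ℂ) ∂μ := by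
    simp_rw [Complex.normSq_eq_conj_mul_self, mul_comm (starRingEnd ℂ (Finset.sum _ _)), map_sum,
      Finset.sum_mul_sum]
    have hi : ∀ k l, Integrable (fun t => φ k t * ξ k * starRingEnd ℂ (φ l t * ξ l)) μ := by
      intro k l
      refine ((h k l).mul_const (ξ k * starRingEnd ℂ (ξ l))).congr (ae_of_all _ fun t => ?_)
      simp only [map_mul]
      ring
    rw [integral_finsetSum _ fun k _ => integrable_finsetSum _ fun l _ => hi k l]
    refine Finset.sum_congr rfl fun k _ => ?_
    rw [integral_finsetSum _ fun l _ => hi k l]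
    refine Finset.sum_congr rfl fun l _ => ?_
    rw [mul_assoc, ← integral_mul_const]
    congr with t
    simp only [map_mul]
    ring
  rw [h1, integral_complex_ofReal]
  exact_mod_cast integral_nonneg fun t => Complex.normSq_nonneg _

theorem cexp_I_mul_sub_conj (t : ℝ) (z w : ℂ) :
    Complex.exp (Complex.I * t * (z - starRingEnd ℂ w)) =
      Complex.exp (Complex.I * t * z) * starRingEnd ℂ (Complex.exp (Complex.I * t * w)) := by
  rw [← Complex.exp_conj, ← Complex.exp_add]
  simp only [map_mul, Complex.conj_I, Complex.conj_ofReal]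
  ring_nf

/-- A Fourier–Laplace transform is positive definite. -/
theorem FourierLaplaceRep.isPosDefOn {f : ℂ → ℂ} {S : Set ℂ} {μ : Measure ℝ}
    (h : FourierLaplaceRep f S μ) : IsPosDefOn f S := by
  intro n z hz ξ
  simp_rw [fun k l => (h _ (hz k l)).2, cexp_I_mul_sub_conj]
  refine sum_integral_mul_conj_nonneg (φ := fun k t => Complex.exp (Complex.I * t * z k))
    (fun k l => ?_) ξ
  simp_rw [← cexp_I_mul_sub_conj]
  exact (h _ (hz k l)).1

/-- The easy half of Bochner's theorem. -/
theorem BochnerRep.isPosDefReal {F : ℝ → ℂ} {μ : Measure ℝ} (h : BochnerRep F μ) :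
    IsPosDefReal F := by
  intro n x ξ
  have e : ∀ k l (t : ℝ), Complex.exp (Complex.I * t * ((x k - x l : ℝ) : ℂ)) =
      Complex.exp (Complex.I * t * x k) * starRingEnd ℂ (Complex.exp (Complex.I * t * x l)) := by
    intro k l t
    rw [← cexp_I_mul_sub_conj, Complex.conj_ofReal, Complex.ofReal_sub]
  simp_rw [fun k l => (h (x k - x l)).2, e]
  refine sum_integral_mul_conj_nonneg (φ := fun k t => Complex.exp (Complex.I * t * x k))
    (fun k l => ?_) ξ
  simp_rw [← e]
  exact (h _).1

/-- The easy half of Widder's theorem. -/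
theorem WidderRep.isCoPosDefOn {G : ℝ → ℂ} {J : Set ℝ} {μ : Measure ℝ} (h : WidderRep G J μ) :
    IsCoPosDefOn G J := by
  intro n x hx ξ
  have e : ∀ k l (t : ℝ), ((Real.exp (-((x k + x l) * t)) : ℝ) : ℂ) =
      (Real.exp (-(x k * t)) : ℂ) * starRingEnd ℂ (Real.exp (-(x l * t)) : ℂ) := by
    intro k l t
    rw [Complex.conj_ofReal, ← Complex.ofReal_mul, ← Real.exp_add]
    ring_nf
  simp_rw [fun k l => (h _ (hx k l)).2, ← integral_complex_ofReal, e]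
  refine sum_integral_mul_conj_nonneg (φ := fun k t => (Real.exp (-(x k * t)) : ℂ))
    (fun k l => ?_) ξ
  simp_rw [← e]
  exact (h _ (hx k l)).1.ofReal

/-! ### Sections and uniqueness -/

theorem integrable_cexp_iff {μ : Measure ℝ} {z : ℂ} :
    Integrable (fun t : ℝ => Complex.exp (Complex.I * t * z)) μ ↔
      Integrable (fun t => Real.exp (-(z.im * t))) μ := by
  rw [← integrable_norm_iff (by fun_prop)]
  have : ∀ t : ℝ, ‖Complex.exp (Complex.I * t * z)‖ = Real.exp (-(z.im * t)) := by
    intro t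
    rw [Complex.norm_exp]
    congr 1
    simp
    ring
  simp_rw [this]

/-- The uniqueness part of Bochner's theorem. -/
theorem BochnerRep.unique {F : ℝ → ℂ} {μ ν : Measure ℝ} [IsFiniteMeasure μ] [IsFiniteMeasure ν]
    (hμ : BochnerRep F μ) (hν : BochnerRep F ν) : μ = ν := by
  refine Measure.ext_of_charFun (funext fun x => ?_)
  have e : ∀ t : ℝ, Complex.exp (x * t * Complex.I) = Complex.exp (Complex.I * t * x) := by
    intro t; ring_nf
  rw [charFun_apply_real, charFun_apply_real]
  simp_rw [e]
  rw [← (hμ x).2, ← (hν x).2]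

theorem expTilt_neg_cexp (y x t : ℝ) :
    Real.exp (-y * t) • Complex.exp (Complex.I * t * x) =
      Complex.exp (Complex.I * t * (x + Complex.I * y)) := by
  rw [mul_add, Complex.exp_add, cexp_I_mul_I_mul, Complex.real_smul, mul_comm, neg_mul]

/-- Tilting the measure of a Fourier–Laplace transform represents its horizontal sections. -/
theorem FourierLaplaceRep.bochnerRep {f : ℂ → ℂ} {S : Set ℂ} {μ : Measure ℝ}
    (h : FourierLaplaceRep f S μ) {y : ℝ} (hy : ∀ x : ℝ, (x : ℂ) + Complex.I * y ∈ S) :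
    BochnerRep (horizontalSection f y) (expTilt μ (-y)) := by
  intro x
  rw [integrable_expTilt_iff, integral_expTilt]
  simp_rw [expTilt_neg_cexp]
  exact h _ (hy x)

theorem FourierLaplaceRep.widderRep {f : ℂ → ℂ} {J : Set ℝ} {μ : Measure ℝ}
    (h : FourierLaplaceRep f (Complex.im ⁻¹' J) μ) : WidderRep (imaginarySection f) J μ := by
  intro y hy
  have h1 := h (Complex.I * y) (by simpa using hy)
  refine ⟨by simpa using integrable_cexp_iff.1 h1.1, ?_⟩
  rw [imaginarySection, h1.2, ← integral_complex_ofReal]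
  simp_rw [cexp_I_mul_I_mul]

/-- Uniqueness of the measure in Widder's theorem: the two Laplace transforms extend to
holomorphic functions on a strip, which agree by the identity theorem, so the tilted measures have
the same characteristic function. -/
theorem WidderRep.unique {G : ℝ → ℂ} {J : Set ℝ} (hJo : IsOpen J) (hJc : Convex ℝ J)
    (hJne : J.Nonempty) {μ ν : Measure ℝ} (hμ : WidderRep G J μ) (hν : WidderRep G J ν) :
    μ = ν := by
  obtain ⟨y, hy⟩ := hJne
  have hμJ := subset_expDomain hJo fun u hu => (hμ u hu).1
  have hνJ := subset_expDomain hJo fun u hu => (hν u hu).1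
  have hopen : IsOpen (Complex.im ⁻¹' J) := hJo.preimage Complex.continuous_im
  have heq : Set.EqOn (fun z : ℂ => ∫ t : ℝ, Complex.exp (Complex.I * t * z) ∂μ)
      (fun z : ℂ => ∫ t : ℝ, Complex.exp (Complex.I * t * z) ∂ν) (Complex.im ⁻¹' J) := by
    refine AnalyticOnNhd.eqOn_of_preconnected_of_frequently_eq (z₀ := Complex.I * y)
      (((differentiableOn_integral_cexp μ).mono fun z hz => hμJ hz).analyticOnNhd hopen)
      (((differentiableOn_integral_cexp ν).mono fun z hz => hνJ hz).analyticOnNhd hopen)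
      (hJc.linear_preimage Complex.imLm).isPreconnected (by simpa using hy) ?_
    have hreal : ∃ᶠ u : ℝ in nhdsWithin y {y}ᶜ, u ∈ J :=
      (Filter.Eventually.frequently (nhdsWithin_le_nhds (hJo.mem_nhds hy)))
    have htend : Filter.Tendsto (fun u : ℝ => Complex.I * u) (nhdsWithin y {y}ᶜ)
        (nhdsWithin (Complex.I * y) {Complex.I * (y : ℂ)}ᶜ) := by
      refine tendsto_nhdsWithin_iff.2 ⟨?_, ?_⟩
      · have : Continuous fun u : ℝ => Complex.I * (u : ℂ) := by fun_prop
        exact (this.tendsto y).mono_left nhdsWithin_le_nhds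
      · filter_upwards [self_mem_nhdsWithin] with u hu
        simpa using hu
    refine htend.frequently (hreal.mono fun u hu => ?_)
    simp_rw [cexp_I_mul_I_mul]
    rw [integral_complex_ofReal, integral_complex_ofReal, ← (hμ u hu).2, ← (hν u hu).2]
  have hfin : ∀ ρ : Measure ℝ, WidderRep G J ρ → IsFiniteMeasure (expTilt ρ (-y)) :=
    fun ρ hρ => isFiniteMeasure_expTilt (by simpa using (hρ y hy).1)
  have := hfin μ hμ
  have := hfin ν hν
  have hF : ∀ ρ : Measure ℝ, WidderRep G J ρ → FourierLaplaceRep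
      (fun z : ℂ => ∫ t : ℝ, Complex.exp (Complex.I * t * z) ∂ρ) (Complex.im ⁻¹' J) ρ :=
    fun ρ hρ z hz => ⟨integrable_cexp_iff.2 (hρ _ hz).1, rfl⟩
  have hmem : ∀ x : ℝ, (x : ℂ) + Complex.I * y ∈ Complex.im ⁻¹' J := fun x => by simpa using hy
  have hμB := (hF μ hμ).bochnerRep hmem
  have hνB := (hF ν hν).bochnerRep hmem
  have htilt : expTilt μ (-y) = expTilt ν (-y) := by
    refine BochnerRep.unique hμB fun x => ⟨(hνB x).1, ?_⟩
    rw [← (hνB x).2]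
    exact heq (hmem x)
  rw [← expTilt_expTilt_neg μ (-y), htilt, expTilt_expTilt_neg]

/-! ### Restriction to real lines -/

/-- The derivatives of a holomorphic function along a real line. -/
theorem iteratedDeriv_comp_line {f : ℂ → ℂ} {S : Set ℂ} (hS : IsOpen S)
    (hf : DifferentiableOn ℂ f S) (p w : ℂ) {T : Set ℝ} (hT : IsOpen T)
    (hTS : ∀ x ∈ T, p + w * x ∈ S) (n : ℕ) {x : ℝ} (hx : x ∈ T) :
    iteratedDeriv n (fun x : ℝ => f (p + w * x)) x = w ^ n * iteratedDeriv n f (p + w * x) := by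
  induction n generalizing x with
  | zero => simp
  | succ n ih =>
    have hline : HasDerivAt (fun x : ℝ => p + w * (x : ℂ)) w x := by
      simpa using ((Complex.ofRealCLM.hasDerivAt (x := x)).const_mul w).const_add p
    have hd : HasDerivAt (iteratedDeriv n f) (iteratedDeriv (n + 1) f (p + w * x)) (p + w * x) := by
      rw [iteratedDeriv_succ]
      refine DifferentiableAt.hasDerivAt ?_
      rw [iteratedDeriv_eq_iterate]
      exact ((hf.analyticOnNhd hS).iterated_deriv n _ (hTS x hx)).differentiableAt
    rw [iteratedDeriv_succ]
    refine HasDerivAt.deriv ?_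
    have h1 : HasDerivAt (fun x : ℝ => w ^ n * iteratedDeriv n f (p + w * x))
        (w ^ (n + 1) * iteratedDeriv (n + 1) f (p + w * x)) x := by
      refine ((hd.comp x hline).const_mul (w ^ n)).congr_deriv ?_
      ring
    refine h1.congr_of_eventuallyEq ?_
    filter_upwards [hT.mem_nhds hx] with u hu using ih hu

theorem contDiffOn_comp_line {f : ℂ → ℂ} {S : Set ℂ} (hS : IsOpen S)
    (hf : DifferentiableOn ℂ f S) (p w : ℂ) {T : Set ℝ}
    (hTS : ∀ x ∈ T, p + w * x ∈ S) : ContDiffOn ℝ ∞ (fun x : ℝ => f (p + w * x)) T := by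
  have h1 : ContDiffOn ℝ ∞ f S := (hf.contDiffOn hS).restrict_scalars ℝ
  have h2 : ContDiff ℝ ∞ (fun x : ℝ => p + w * (x : ℂ)) :=
    contDiff_const.add (contDiff_const.mul Complex.ofRealCLM.contDiff)
  exact h1.comp h2.contDiffOn hTS

/-! ### Strips and intervals with extended real endpoints -/

theorem isOpen_realInterval (a b : EReal) : IsOpen (realInterval a b) :=
  isOpen_Ioo.preimage continuous_coe_real_ereal

theorem convex_realInterval (a b : EReal) : Convex ℝ (realInterval a b) := by
  refine Set.OrdConnected.convex ⟨fun x hx y hy z hz => ⟨?_, ?_⟩⟩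
  · exact hx.1.trans_le (by exact_mod_cast hz.1)
  · exact lt_of_le_of_lt (by exact_mod_cast hz.2) hy.2

theorem nonempty_realInterval {a b : EReal} (h : a < b) : (realInterval a b).Nonempty :=
  EReal.lt_iff_exists_real_btwn.1 h

theorem add_mem_of_mem_realInterval_sub {a b : EReal} {y u : ℝ}
    (hu : u ∈ realInterval (a - (y : EReal)) (b - (y : EReal))) : u + y ∈ realInterval a b := by
  obtain ⟨h1, h2⟩ := hu
  refine ⟨?_, ?_⟩
  · rw [EReal.coe_add]
    exact (EReal.sub_lt_iff (by simp) (by simp)).1 h1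
  · rw [EReal.coe_add]
    exact (EReal.lt_sub_iff_add_lt (by simp) (by simp)).1 h2

/-! ### Positive definite holomorphic functions are Fourier–Laplace transforms -/

theorem IsPosDefOn.isPosDefReal {f : ℂ → ℂ} {J : Set ℝ} (h : IsPosDefOn f (Complex.im ⁻¹' J))
    {y : ℝ} (hy : y ∈ J) : IsPosDefReal (horizontalSection f y) := by
  intro n x ξ
  -- the points `x k + i y / 2` have differences `z - conj z'` on the line `Im = y`
  have e : ∀ k l, (x k + Complex.I * ((y / 2 : ℝ) : ℂ)) -
      starRingEnd ℂ (x l + Complex.I * ((y / 2 : ℝ) : ℂ)) =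
      ((x k - x l : ℝ) : ℂ) + Complex.I * y := by
    intro k l
    simp only [map_add, map_mul, Complex.conj_I, Complex.conj_ofReal]
    push_cast
    ring
  have := h n (fun k => x k + Complex.I * ((y / 2 : ℝ) : ℂ)) (fun k l => by
    rw [e]; simpa using hy) ξ
  simpa only [e, horizontalSection] using this

theorem IsPosDefOn.isCoPosDefOn {f : ℂ → ℂ} {J : Set ℝ} (h : IsPosDefOn f (Complex.im ⁻¹' J)) :
    IsCoPosDefOn (imaginarySection f) J := by
  intro n x hx ξ
  have e : ∀ k l, Complex.I * x k - starRingEnd ℂ (Complex.I * x l) =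
      Complex.I * ((x k + x l : ℝ) : ℂ) := by
    intro k l
    simp only [map_mul, Complex.conj_I, Complex.conj_ofReal]
    push_cast
    ring
  have := h n (fun k => Complex.I * x k) (fun k l => by
    rw [e]; simpa using hx k l) ξ
  simpa only [e, imaginarySection] using this

/-- A holomorphic function on a strip with one positive definite horizontal section is a
Fourier–Laplace transform. -/
theorem IsPosDefReal.exists_fourierLaplaceRep {f : ℂ → ℂ} {J : Set ℝ} (hJo : IsOpen J)
    (hJc : Convex ℝ J) (hf : DifferentiableOn ℂ f (Complex.im ⁻¹' J)) {y : ℝ} (hy : y ∈ J)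
    (h : IsPosDefReal (horizontalSection f y)) :
    ∃ μ : Measure ℝ, IsLocallyFiniteMeasure μ ∧ FourierLaplaceRep f (Complex.im ⁻¹' J) μ := by
  obtain ⟨μ, hμ, hJ, hrep⟩ := exists_measure_of_local_posDef hJo hJc hf hy one_ne_zero one_pos
    fun n x ξ _ => by
      have e : ∀ k l, Complex.I * y + (1 * (x k : ℂ) - starRingEnd ℂ (1 * (x l : ℂ))) =
          ((x k - x l : ℝ) : ℂ) + Complex.I * y := by
        intro k l
        simp only [one_mul, Complex.conj_ofReal]
        push_cast
        ring
      simp_rw [e]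
      exact h n x ξ
  exact ⟨μ, hμ, fun z hz => ⟨integrable_cexp_iff.2 (integrable_exp_of_mem_expDomain (hJ hz)),
    hrep z hz⟩⟩

/-- A holomorphic function on a strip whose restriction to the imaginary axis is co-positive
definite is a Fourier–Laplace transform. -/
theorem IsCoPosDefOn.exists_fourierLaplaceRep {f : ℂ → ℂ} {J : Set ℝ} (hJo : IsOpen J)
    (hJc : Convex ℝ J) (hJne : J.Nonempty) (hf : DifferentiableOn ℂ f (Complex.im ⁻¹' J))
    (h : IsCoPosDefOn (imaginarySection f) J) :
    ∃ μ : Measure ℝ, IsLocallyFiniteMeasure μ ∧ FourierLaplaceRep f (Complex.im ⁻¹' J) μ := by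
  obtain ⟨y, hy⟩ := hJne
  obtain ⟨r, hr, hrJ⟩ := Metric.isOpen_iff.1 hJo y hy
  obtain ⟨μ, hμ, hJ, hrep⟩ := exists_measure_of_local_posDef hJo hJc hf hy Complex.I_ne_zero
    (half_pos hr) fun n x ξ hx => by
      have e : ∀ k l, Complex.I * y +
          (Complex.I * (x k : ℂ) - starRingEnd ℂ (Complex.I * (x l : ℂ))) =
          Complex.I * (((y / 2 + x k) + (y / 2 + x l) : ℝ) : ℂ) := by
        intro k l
        simp only [map_mul, Complex.conj_I, Complex.conj_ofReal]
        push_cast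
        ring
      simp_rw [e]
      refine h n (fun k => y / 2 + x k) (fun k l => hrJ ?_) ξ
      have h1 := abs_lt.1 (hx k)
      have h2 := abs_lt.1 (hx l)
      rw [Metric.mem_ball, Real.dist_eq, abs_lt]
      constructor <;> linarith
  exact ⟨μ, hμ, fun z hz => ⟨integrable_cexp_iff.2 (integrable_exp_of_mem_expDomain (hJ hz)),
    hrep z hz⟩⟩

/-! ### Consequences of the representation -/

theorem FourierLaplaceRep.subset_expDomain {f : ℂ → ℂ} {J : Set ℝ} (hJo : IsOpen J)
    {μ : Measure ℝ} (h : FourierLaplaceRep f (Complex.im ⁻¹' J) μ) : J ⊆ expDomain μ :=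
  _root_.subset_expDomain hJo fun u hu => (h.widderRep u hu).1

theorem FourierLaplaceRep.iteratedDeriv_eq {f : ℂ → ℂ} {J : Set ℝ} (hJo : IsOpen J)
    {μ : Measure ℝ} (h : FourierLaplaceRep f (Complex.im ⁻¹' J) μ) (n : ℕ) {z : ℂ}
    (hz : z.im ∈ J) :
    iteratedDeriv n f z =
      ∫ t : ℝ, (Complex.I * t) ^ n * Complex.exp (Complex.I * t * z) ∂μ := by
  rw [← iteratedDeriv_integral_cexp (h.subset_expDomain hJo hz)]
  refine Filter.EventuallyEq.iteratedDeriv_eq n ?_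
  filter_upwards [(hJo.preimage Complex.continuous_im).mem_nhds hz] with w hw using (h w hw).2

theorem integrable_neg_pow_mul_exp {μ : Measure ℝ} {c : ℝ} (hc : c ∈ expDomain μ) (n : ℕ) :
    Integrable (fun t : ℝ => (-t) ^ n * Real.exp (-(c * t))) μ := by
  refine ((integrable_pow_mul_exp hc n).const_mul ((-1) ^ n)).congr (ae_of_all _ fun t => ?_)
  simp only
  rw [neg_pow t, mul_assoc]

theorem FourierLaplaceRep.iteratedDeriv_imaginarySection {f : ℂ → ℂ} {J : Set ℝ}
    (hJo : IsOpen J) {μ : Measure ℝ} (h : FourierLaplaceRep f (Complex.im ⁻¹' J) μ)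
    (hf : DifferentiableOn ℂ f (Complex.im ⁻¹' J)) (n : ℕ) {y : ℝ} (hy : y ∈ J) :
    iteratedDeriv n (imaginarySection f) y =
      ((∫ t : ℝ, (-t) ^ n * Real.exp (-(y * t)) ∂μ : ℝ) : ℂ) := by
  have h1 := iteratedDeriv_comp_line (hJo.preimage Complex.continuous_im) hf 0 Complex.I hJo
    (fun x hx => by simpa using hx) n hy
  simp only [zero_add] at h1
  have h2 : imaginarySection f = fun x : ℝ => f (Complex.I * x) := rfl
  rw [h2, h1, h.iteratedDeriv_eq hJo n (by simpa using hy), integral_pow_mul_cexp_I_mul,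
    ← mul_assoc, ← mul_pow, Complex.I_mul_I]
  have e : ∀ t : ℝ, (-t) ^ n * Real.exp (-(y * t)) = (-1) ^ n * (t ^ n * Real.exp (-(y * t))) := by
    intro t
    rw [neg_pow t, mul_assoc]
  simp_rw [e]
  rw [integral_const_mul]
  push_cast
  ring

theorem FourierLaplaceRep.isExpFinite {f : ℂ → ℂ} {J : Set ℝ} {μ : Measure ℝ}
    (h : FourierLaplaceRep f (Complex.im ⁻¹' J) μ) : IsExpFinite μ J :=
  fun u hu => (h.widderRep u hu).1.lintegral_lt_top

theorem FourierLaplaceRep.isFiniteMeasure_expTilt {f : ℂ → ℂ} {J : Set ℝ} {μ : Measure ℝ}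
    (h : FourierLaplaceRep f (Complex.im ⁻¹' J) μ) {y : ℝ} (hy : y ∈ J) :
    IsFiniteMeasure (expTilt μ (-y)) :=
  _root_.isFiniteMeasure_expTilt (by simpa using (h.widderRep y hy).1)

theorem FourierLaplaceRep.isExpFinite_expTilt {f : ℂ → ℂ} {a b : EReal} {μ : Measure ℝ}
    (h : FourierLaplaceRep f (horizontalStrip a b) μ) (y : ℝ) :
    IsExpFinite (expTilt μ (-y)) (realInterval (a - (y : EReal)) (b - (y : EReal))) := by
  intro u hu
  refine Integrable.lintegral_lt_top ?_
  rw [integrable_expTilt_iff]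
  refine (FourierLaplaceRep.widderRep (J := realInterval a b) h _
    (add_mem_of_mem_realInterval_sub hu)).1.congr (ae_of_all _ fun t => ?_)
  simp only [smul_eq_mul]
  rw [← Real.exp_add]
  ring_nf

theorem mainTheorem2 (a b : EReal) (hab : a < b) (f : ℂ → ℂ)
    (hf : DifferentiableOn ℂ f (horizontalStrip a b)) :
    -- the six equivalent conditions
    List.TFAE
      [ IsPosDefOn f (horizontalStrip a b),
        ∃ μ : Measure ℝ, IsLocallyFiniteMeasure μ ∧ FourierLaplaceRep f (horizontalStrip a b) μ,
        ∃ y ∈ realInterval a b, IsPosDefReal (horizontalSection f y),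
        ∃ y ∈ realInterval a b, ∃ μy : Measure ℝ, IsFiniteMeasure μy ∧
          BochnerRep (horizontalSection f y) μy,
        IsCoPosDefOn (imaginarySection f) (realInterval a b),
        ∃ μI : Measure ℝ, IsLocallyFiniteMeasure μI ∧
          WidderRep (imaginarySection f) (realInterval a b) μI ] ∧
    -- what holds in addition under these conditions
    (IsPosDefOn f (horizontalStrip a b) →
      -- one measure `μ = μ_I`, unique for each of the two representations
      (∃ μ : Measure ℝ, IsLocallyFiniteMeasure μ ∧
        FourierLaplaceRep f (horizontalStrip a b) μ ∧
        (∀ ν : Measure ℝ, IsLocallyFiniteMeasure ν →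
          FourierLaplaceRep f (horizontalStrip a b) ν → ν = μ) ∧
        WidderRep (imaginarySection f) (realInterval a b) μ ∧
        (∀ ν : Measure ℝ, IsLocallyFiniteMeasure ν →
          WidderRep (imaginarySection f) (realInterval a b) ν → ν = μ) ∧
        IsExpFinite μ (realInterval a b) ∧
        -- differentiation of `f` under the integral sign
        ContDiffOn ℂ ∞ f (horizontalStrip a b) ∧
        (∀ n : ℕ, ∀ z ∈ horizontalStrip a b,
          Integrable (fun t : ℝ => (Complex.I * t) ^ n * Complex.exp (Complex.I * t * z)) μ ∧
          iteratedDeriv n f z =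
            ∫ t : ℝ, (Complex.I * t) ^ n * Complex.exp (Complex.I * t * z) ∂μ) ∧
        -- differentiation of `G` under the integral sign
        ContDiffOn ℝ ∞ (imaginarySection f) (realInterval a b) ∧
        (∀ n : ℕ, ∀ y ∈ realInterval a b,
          Integrable (fun t : ℝ => (-t) ^ n * Real.exp (-(y * t))) μ ∧
          iteratedDeriv n (imaginarySection f) y =
            ((∫ t : ℝ, (-t) ^ n * Real.exp (-(y * t)) ∂μ : ℝ) : ℂ))) ∧
      -- the measures `μ_y`
      (∀ y ∈ realInterval a b, ∃ μy : Measure ℝ, IsFiniteMeasure μy ∧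
        BochnerRep (horizontalSection f y) μy ∧
        (∀ ν : Measure ℝ, IsFiniteMeasure ν → BochnerRep (horizontalSection f y) ν → ν = μy) ∧
        IsExpFinite μy (realInterval (a - (y : EReal)) (b - (y : EReal))) ∧
        -- differentiation of `F_y` under the integral sign
        ContDiff ℝ ∞ (horizontalSection f y) ∧
        (∀ n : ℕ, ∀ x : ℝ,
          Integrable (fun t : ℝ => (Complex.I * t) ^ n * Complex.exp (Complex.I * t * x)) μy ∧
          iteratedDeriv n (horizontalSection f y) x =
            ∫ t : ℝ, (Complex.I * t) ^ n * Complex.exp (Complex.I * t * x) ∂μy))) := by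
  set J := realInterval a b with hJ
  have hS : horizontalStrip a b = Complex.im ⁻¹' J := rfl
  have hJo : IsOpen J := isOpen_realInterval a b
  have hJc : Convex ℝ J := convex_realInterval a b
  have hJne : J.Nonempty := nonempty_realInterval hab
  have hmem : ∀ y ∈ J, ∀ x : ℝ, (x : ℂ) + Complex.I * y ∈ horizontalStrip a b :=
    fun y hy x => by rw [hS]; simpa using hy
  have hSo : IsOpen (horizontalStrip a b) := hJo.preimage Complex.continuous_im
  have h13 : IsPosDefOn f (horizontalStrip a b) →
      ∃ y ∈ J, IsPosDefReal (horizontalSection f y) := fun h =>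
    ⟨hJne.some, hJne.some_mem, IsPosDefOn.isPosDefReal h hJne.some_mem⟩
  have h32 : (∃ y ∈ J, IsPosDefReal (horizontalSection f y)) →
      ∃ μ : Measure ℝ, IsLocallyFiniteMeasure μ ∧ FourierLaplaceRep f (horizontalStrip a b) μ :=
    fun ⟨_, hy, h⟩ => h.exists_fourierLaplaceRep hJo hJc hf hy
  refine ⟨?_, fun hpd => ?_⟩
  · tfae_have 1 → 3 := h13
    tfae_have 3 → 2 := h32
    tfae_have 2 → 1 := fun ⟨_, _, h⟩ => h.isPosDefOn
    tfae_have 2 → 4 := fun ⟨μ, _, h⟩ => ⟨hJne.some, hJne.some_mem, expTilt μ (-hJne.some),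
      FourierLaplaceRep.isFiniteMeasure_expTilt h hJne.some_mem,
      h.bochnerRep (hmem _ hJne.some_mem)⟩
    tfae_have 4 → 3 := fun ⟨y, hy, _, _, h⟩ => ⟨y, hy, h.isPosDefReal⟩
    tfae_have 1 → 5 := fun h => IsPosDefOn.isCoPosDefOn h
    tfae_have 5 → 2 := fun h => h.exists_fourierLaplaceRep hJo hJc hJne hf
    tfae_have 2 → 6 := fun ⟨μ, hμ, h⟩ => ⟨μ, hμ, FourierLaplaceRep.widderRep h⟩
    tfae_have 6 → 5 := fun ⟨_, _, h⟩ => h.isCoPosDefOn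
    tfae_finish
  obtain ⟨μ, hμ, h⟩ := h32 (h13 hpd)
  have hw : WidderRep (imaginarySection f) J μ := FourierLaplaceRep.widderRep h
  have hdom : J ⊆ expDomain μ := FourierLaplaceRep.subset_expDomain hJo h
  refine ⟨⟨μ, hμ, h,
    fun ν _ hν => (FourierLaplaceRep.widderRep hν).unique hJo hJc hJne hw, hw,
    fun ν _ hν => hν.unique hJo hJc hJne hw, FourierLaplaceRep.isExpFinite h,
    hf.contDiffOn hSo,
    fun n z hz => ⟨integrable_pow_mul_cexp (hdom hz) n,
      FourierLaplaceRep.iteratedDeriv_eq hJo h n hz⟩,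
    ?_, fun n y hy => ⟨integrable_neg_pow_mul_exp (hdom hy) n,
      FourierLaplaceRep.iteratedDeriv_imaginarySection hJo h hf n hy⟩⟩, fun y hy => ?_⟩
  · have := contDiffOn_comp_line hSo hf 0 Complex.I (T := J) fun x hx => by
      rw [hS]; simpa using hx
    simp only [zero_add] at this
    exact this
  have hline : horizontalSection f y = fun x : ℝ => f (Complex.I * y + 1 * x) := by
    funext x
    rw [horizontalSection, one_mul, add_comm]
  have hlmem : ∀ x ∈ (Set.univ : Set ℝ), Complex.I * y + 1 * (x : ℂ) ∈ horizontalStrip a b :=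
    fun x _ => by rw [one_mul, add_comm]; exact hmem y hy x
  have hfin := FourierLaplaceRep.isFiniteMeasure_expTilt h hy
  have hB := h.bochnerRep (hmem y hy)
  refine ⟨expTilt μ (-y), hfin, hB, fun ν _ hν => hν.unique hB, h.isExpFinite_expTilt y, ?_,
    fun n x => ?_⟩
  · rw [hline, ← contDiffOn_univ]
    exact contDiffOn_comp_line hSo hf _ 1 hlmem
  have hsm : ∀ t : ℝ, Real.exp (-y * t) •
      ((Complex.I * t) ^ n * Complex.exp (Complex.I * t * x)) =
      (Complex.I * t) ^ n * Complex.exp (Complex.I * t * (x + Complex.I * y)) := by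
    intro t
    rw [← expTilt_neg_cexp, mul_smul_comm]
  rw [integrable_expTilt_iff, integral_expTilt]
  simp_rw [hsm]
  refine ⟨integrable_pow_mul_cexp (hdom (hmem y hy x)) n, ?_⟩
  rw [hline, iteratedDeriv_comp_line hSo hf _ 1 isOpen_univ hlmem n (Set.mem_univ x), one_pow,
    one_mul, one_mul, add_comm]
  exact FourierLaplaceRep.iteratedDeriv_eq hJo h n (hmem y hy x)
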